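/- **Lemma 2.4 ($L^\infty$ bound, maximum principle).** Let $\Omega\subset\mathbb R^3$ be a bounded domain with smooth boundary, let $a,b,c>0$, $\varepsilon>0$ and $T_1\in(0,\infty)$. Let $\mathcal Q=\{Q\in\mathbb R^{3\times3}: Q=Q^T,\ \operatorname{tr}Q=0\}$ with $A:B=\sum_{i,j}A_{ij}B_{ij}$ and $|A|=(A:A)^{1/2}$, and let $$F(Q)=\tfrac a2\operatorname{tr}(Q^2)-\tfrac b3\operatorname{tr}(Q^3)+\tfrac c4(\operatorname{tr}(Q^2))^2,\qquad DF(Q)=aQ-bQ^2+c|Q|^2Q+\tfrac b3|Q|^2I,\qquad F_\varepsilon=F+\varepsilon^3 .$$ Consider the Beris–Edwards system in $\Omega\times(0,T_1)$ $$\partial_t\mathbf v+(\mathbf v\cdot\nabla)\mathbf v-\Delta\mathbf v+\nabla p=-\varepsilon\operatorname{div}(\nabla Q\odot\nabla Q),\quad \operatorname{div}\mathbf v=0,\quad \partial_tQ+(\mathbf v\cdot\nabla)Q=\Delta Q-\tfrac1{\varepsilon^2}DF(Q),$$ where $(\nabla Q\odot\nabla Q)_{ij}=\partial_iQ:\partial_jQ$,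 with $\mathbf v=0$, $Q=0$ on $\partial\Omega\times(0,T_1)$ and $\mathbf v|_{t=0}=\mathbf v_{0,\varepsilon}$, $Q|_{t=0}=Q_{0,\varepsilon}$. Let $L^2_\sigma(\Omega)$ be the space of $\mathbf v\in L^2(\Omega;\mathbb R^3)$ with $\operatorname{div}\mathbf v=0$ and vanishing generalized normal trace, and let $H^1_{0,\sigma}(\Omega)$ be the space of divergence-free $\mathbf v\in H^1_0(\Omega;\mathbb R^3)$; let $BC_w([0,T];X)$ denote the bounded weakly continuous functions $[0,T]\to X$. A global weak solution on $[0,T_1]$ is a pair $(\mathbf v_\varepsilon,Q_\varepsilon)$ which attains the initial data, satisfies $Q_\varepsilon(t)\in H^1_0(\Omega;\mathcal Q)$ for $t\in(0,T_1)$, and is such that for all $T\in(0,T_1)$: (i) $\mathbf v_\varepsilon\in BC_w([0,T];L^2_\sigma(\Omega))\cap L^2(0,T;H^1_{0,\sigma}(\Omega))$ and $Q_\varepsilon\in BC_w([0,T];H^1(\Omega;\mathcal Q))\cap L^2(0,T;H^2(\Omega;\mathcal Q))$; (ii) for all $\boldsymbol\eta\in C^1([0,T];H^1_{0,\sigma}(\Omega)\cap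 W^{1,\infty}(\Omega;\mathbb R^3))$ and $\Psi\in C^1([0,T];H^1(\Omega;\mathcal Q))$, $$\int_\Omega\boldsymbol\eta\cdot\mathbf v_\varepsilon\,dx\Big|_{0}^{T}+\int_0^T\!\!\int_\Omega\big(-\partial_t\boldsymbol\eta\cdot\mathbf v_\varepsilon-\mathbf v_\varepsilon\otimes\mathbf v_\varepsilon:\nabla\boldsymbol\eta+\nabla\mathbf v_\varepsilon:\nabla\boldsymbol\eta\big)\,dx\,dt=\varepsilon\int_0^T\!\!\int_\Omega(\nabla Q_\varepsilon\odot\nabla Q_\varepsilon):\nabla\boldsymbol\eta\,dx\,dt,$$ $$\int_\Omega Q_\varepsilon:\Psi\,dx\Big|_{0}^{T}+\int_0^T\!\!\int_\Omega\big(-Q_\varepsilon:\partial_t\Psi+(\mathbf v_\varepsilon\cdot\nabla)Q_\varepsilon:\Psi\big)\,dx\,dt=\int_0^T\!\!\int_\Omega\big(\Delta Q_\varepsilon-\tfrac1{\varepsilon^2}DF(Q_\varepsilon)\big):\Psi\,dx\,dt;$$ and (iii) for almost every $T\in(0,T_1)$, with $\mathcal E(t)=\tfrac12\int_\Omega|\mathbf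 v_\varepsilon(t)|^2dx+\int_\Omega\big[\tfrac\varepsilon2|\nabla Q_\varepsilon|^2+\tfrac1\varepsilon F_\varepsilon(Q_\varepsilon)\big](t)\,dx$, $$\mathcal E(T)+\int_0^T\!\!\int_\Omega|\nabla\mathbf v_\varepsilon|^2dx\,dt+\int_0^T\!\!\int_\Omega\tfrac1\varepsilon\big|\varepsilon\Delta Q_\varepsilon-\tfrac1\varepsilon DF(Q_\varepsilon)\big|^2dx\,dt\le\mathcal E(0).$$ Let $c_0>0$ satisfy $$c_0^2\ \ge\ \max\Big\{\frac{b^2}{c^2}-\frac{2a}{c},\ \|Q_{0,\varepsilon}\|_{L^\infty(\Omega)}^2\Big\}.$$ Then every global weak solution $(\mathbf v_\varepsilon,Q_\varepsilon)$ satisfies $$\|Q_\varepsilon\|_{L^\infty(\Omega\times(0,T_1))}\le c_0 .$$ In particular the bound depends neither on time nor on $\varepsilon$, as long as $c_0$ satisfies the displayed condition. -/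

import Mathlib

open MeasureTheory Set Filter Topology
open scoped ContDiff ENNReal

noncomputable section

namespace BerisEdwards

/-- Physical space `ℝ³` with the Euclidean structure. -/
abbrev E3 := EuclideanSpace ℝ (Fin 3)

/-- Real `3 × 3` matrices. -/
abbrev Mat3 := Matrix (Fin 3) (Fin 3) ℝ

/-! ### Q-tensors and the bulk energy -/

/-- The space of symmetric traceless `3 × 3` matrices. -/
def QTensor : Set Mat3 := {A | A.transpose = A ∧ A.trace = 0}

/-- The contraction `A : B = ∑ᵢⱼ Aᵢⱼ Bᵢⱼ`. -/
def dot (A B : Mat3) : ℝ := ∑ i, ∑ j, A i j * B i j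

/-- The Frobenius norm `|A| = (A : A)^{1/2}`. -/
def frobNorm (A : Mat3) : ℝ := Real.sqrt (dot A A)

/-- The bulk energy density `F(Q) = a/2 tr(Q²) - b/3 tr(Q³) + c/4 (tr(Q²))²`. -/
def bulk (a b c : ℝ) (A : Mat3) : ℝ :=
  a / 2 * (A * A).trace - b / 3 * (A * A * A).trace + c / 4 * ((A * A).trace) ^ 2

/-- The regularised bulk energy density `F_ε = F + ε³`, which has the same gradient as `F`. -/
def bulkReg (a b c ε : ℝ) (A : Mat3) : ℝ := bulk a b c A + ε ^ 3

/-- The gradient of `F` within the space of Q-tensors: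
`DF(Q) = a Q - b Q² + c |Q|² Q + (b/3) |Q|² I`. -/
def bulkGrad (a b c : ℝ) (A : Mat3) : Mat3 :=
  a • A - b • (A * A) + (c * dot A A) • A + (b / 3 * dot A A) • (1 : Mat3)

/-! ### Domains, weak derivatives, Sobolev spaces -/

/-- Bounded domains of `ℝ³` with smooth boundary: near each boundary point, `Ω` is the sublevel set
`{φ < 0}` of a smooth function with non-vanishing derivative at that point. -/
structure IsSmoothBoundedDomain (Ω : Set E3) : Prop where
  isOpen : IsOpen Ω
  isConnected : IsConnected Ω
  isBounded : Bornology.IsBounded Ω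
  smooth_boundary : ∀ x ∈ frontier Ω, ∃ U : Set E3, IsOpen U ∧ x ∈ U ∧
    ∃ φ : E3 → ℝ, ContDiff ℝ ∞ φ ∧ fderiv ℝ φ x ≠ 0 ∧ Ω ∩ U = {y | φ y < 0} ∩ U

/-- The classical partial derivative `∂ₖ φ`. -/
def pderiv (k : Fin 3) (φ : E3 → ℝ) (x : E3) : ℝ := fderiv ℝ φ x (EuclideanSpace.single k 1)

/-- `φ ∈ C_c^∞(Ω)`. -/
structure IsTestFunction (Ω : Set E3) (φ : E3 → ℝ) : Prop where
  smooth : ContDiff ℝ ∞ φ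
  compact : HasCompactSupport φ
  subset : tsupport φ ⊆ Ω

/-- `g` is the weak partial derivative `∂ₖ u` in `Ω`. -/
structure HasWeakPartial (Ω : Set E3) (k : Fin 3) (u g : E3 → ℝ) : Prop where
  locInt : LocallyIntegrableOn u Ω
  locInt_deriv : LocallyIntegrableOn g Ω
  integral_eq : ∀ φ : E3 → ℝ, IsTestFunction Ω φ →
    ∫ x in Ω, u x * pderiv k φ x = -∫ x in Ω, g x * φ x

/-- `u ∈ L²(Ω)`. -/
def MemL2 (Ω : Set E3) (u : E3 → ℝ) : Prop := MemLp u 2 (volume.restrict Ω)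

/-- `u ∈ L^∞(Ω)`. -/
def MemLinf (Ω : Set E3) (u : E3 → ℝ) : Prop := MemLp u ∞ (volume.restrict Ω)

/-- `u ∈ H¹(Ω)` with weak gradient `Du`, where `Du x k = ∂ₖ u (x)`. -/
structure IsH1With (Ω : Set E3) (u : E3 → ℝ) (Du : E3 → Fin 3 → ℝ) : Prop where
  mem : MemL2 Ω u
  mem_grad : ∀ k, MemL2 Ω (fun x => Du x k)
  weak : ∀ k, HasWeakPartial Ω k u (fun x => Du x k)

/-- The norm of `H¹(Ω)`, in the equivalent form `‖u‖_{L²} + ∑ₖ ‖∂ₖ u‖_{L²}`. -/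
def h1Norm (Ω : Set E3) (u : E3 → ℝ) (Du : E3 → Fin 3 → ℝ) : ℝ≥0∞ :=
  eLpNorm u 2 (volume.restrict Ω) + ∑ k, eLpNorm (fun x => Du x k) 2 (volume.restrict Ω)

/-- The norm of `W^{1,∞}(Ω)`, in the equivalent form `‖u‖_{L^∞} + ∑ₖ ‖∂ₖ u‖_{L^∞}`. -/
def w1infNorm (Ω : Set E3) (u : E3 → ℝ) (Du : E3 → Fin 3 → ℝ) : ℝ≥0∞ :=
  eLpNorm u ∞ (volume.restrict Ω) + ∑ k, eLpNorm (fun x => Du x k) ∞ (volume.restrict Ω)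

/-- `u ∈ H¹₀(Ω)`, the closure of `C_c^∞(Ω)` in `H¹(Ω)` (equivalently, for smooth bounded `Ω`, the
functions in `H¹(Ω)` with vanishing trace), with weak gradient `Du`. -/
structure IsH10With (Ω : Set E3) (u : E3 → ℝ) (Du : E3 → Fin 3 → ℝ) : Prop where
  isH1 : IsH1With Ω u Du
  approx : ∃ φ : ℕ → E3 → ℝ, (∀ n, IsTestFunction Ω (φ n)) ∧
    Tendsto (fun n => h1Norm Ω (fun x => u x - φ n x) (fun x k => Du x k - pderiv k (φ n) x))
      atTop (𝓝 0)

/-- `w ∈ L²_σ(Ω)`: square integrable fields with `div w = 0` in the sense of distributions and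
vanishing generalised normal trace `γ(w)`. The latter is the functional on traces of functions
`φ ∈ H¹(Ω)` given by `⟨γ(w), φ⟩ = ∫_Ω w · ∇φ + ∫_Ω (div w) φ`. -/
structure IsL2Sigma (Ω : Set E3) (w : E3 → E3) : Prop where
  mem : ∀ i, MemL2 Ω (fun x => w x i)
  div_eq_zero : ∀ φ : E3 → ℝ, IsTestFunction Ω φ → ∫ x in Ω, ∑ i, w x i * pderiv i φ x = 0
  normal_trace : ∀ (φ : E3 → ℝ) (Dφ : E3 → Fin 3 → ℝ), IsH1With Ω φ Dφ →
    ∫ x in Ω, ∑ i, w x i * Dφ x i = 0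

/-- `w ∈ H¹_{0,σ}(Ω)` with weak gradient `Dw`, where `Dw x i k = ∂ₖ wᵢ (x)`. -/
structure IsH10SigmaWith (Ω : Set E3) (w : E3 → E3) (Dw : E3 → Mat3) : Prop where
  isH10 : ∀ i, IsH10With Ω (fun x => w x i) (fun x => Dw x i)
  div_eq_zero : ∀ᵐ x ∂(volume.restrict Ω), ∑ i, Dw x i i = 0

/-! ### Spaces of time dependent functions -/

/-- `v ∈ BC_w([0,T]; L²_σ(Ω))`. -/
structure IsBCwL2Sigma (Ω : Set E3) (T : ℝ) (v : ℝ → E3 → E3) : Prop where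
  mem : ∀ t ∈ Icc 0 T, IsL2Sigma Ω (v t)
  bounded : ∃ C : ℝ, ∀ t ∈ Icc 0 T, ∀ i,
    eLpNorm (fun x => v t x i) 2 (volume.restrict Ω) ≤ ENNReal.ofReal C
  weak_cont : ∀ w : E3 → E3, (∀ i, MemL2 Ω (fun x => w x i)) →
    ContinuousOn (fun t => ∫ x in Ω, ∑ i, v t x i * w x i) (Icc 0 T)

/-- `u ∈ BC_w([0,T]; H¹(Ω))`, with weak gradients `Du t`. The continuous linear functionals on
`H¹(Ω)` are the maps `u ↦ ∫ u f + ∑ₖ ∫ ∂ₖu gₖ` with `f, gₖ ∈ L²(Ω)`. -/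
structure IsBCwH1 (Ω : Set E3) (T : ℝ) (u : ℝ → E3 → ℝ) (Du : ℝ → E3 → Fin 3 → ℝ) : Prop where
  mem : ∀ t ∈ Icc 0 T, IsH1With Ω (u t) (Du t)
  bounded : ∃ C : ℝ, ∀ t ∈ Icc 0 T, h1Norm Ω (u t) (Du t) ≤ ENNReal.ofReal C
  weak_cont : ∀ (f : E3 → ℝ) (g : E3 → Fin 3 → ℝ), MemL2 Ω f → (∀ k, MemL2 Ω (fun x => g x k)) →
    ContinuousOn
      (fun t => (∫ x in Ω, u t x * f x) + ∑ k, ∫ x in Ω, Du t x k * g x k) (Icc 0 T)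

/-- `u ∈ L²(Ω × (0,T))`, as a jointly measurable function; this is `L²(0,T; L²(Ω))`. -/
def MemL2L2 (Ω : Set E3) (T : ℝ) (u : ℝ → E3 → ℝ) : Prop :=
  MemLp (fun p : E3 × ℝ => u p.2 p.1) 2 (volume.restrict (Ω ×ˢ Ioo 0 T))

/-- `v ∈ L²(0,T; H¹_{0,σ}(Ω))`, with weak spatial gradients `Dv t`. -/
structure IsL2H10Sigma (Ω : Set E3) (T : ℝ) (v : ℝ → E3 → E3) (Dv : ℝ → E3 → Mat3) : Prop where
  mem : ∀ i, MemL2L2 Ω T (fun t x => v t x i)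
  mem_grad : ∀ i k, MemL2L2 Ω T (fun t x => Dv t x i k)
  slice : ∀ᵐ t ∂(volume.restrict (Ioo 0 T)), IsH10SigmaWith Ω (v t) (Dv t)

/-- `u ∈ L²(0,T; H²(Ω))`, with weak spatial derivatives `Du t x k = ∂ₖ u` and
`D2u t x k l = ∂ₗ ∂ₖ u`. -/
structure IsL2H2 (Ω : Set E3) (T : ℝ) (u : ℝ → E3 → ℝ) (Du : ℝ → E3 → Fin 3 → ℝ)
    (D2u : ℝ → E3 → Fin 3 → Fin 3 → ℝ) : Prop where
  mem : MemL2L2 Ω T u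
  mem_grad : ∀ k, MemL2L2 Ω T (fun t x => Du t x k)
  mem_hess : ∀ k l, MemL2L2 Ω T (fun t x => D2u t x k l)
  slice : ∀ᵐ t ∂(volume.restrict (Ioo 0 T)),
    IsH1With Ω (u t) (Du t) ∧ ∀ k, IsH1With Ω (fun x => Du t x k) (fun x => D2u t x k)

/-- The curve `t ↦ u t` is `C¹` on `[0,T]` with derivative `t ↦ ut t`, with respect to the norm `N`
(a function of `u` and of its weak gradient). -/
structure IsC1Curve (N : (E3 → ℝ) → (E3 → Fin 3 → ℝ) → ℝ≥0∞) (T : ℝ)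
    (u : ℝ → E3 → ℝ) (Du : ℝ → E3 → Fin 3 → ℝ)
    (ut : ℝ → E3 → ℝ) (Dut : ℝ → E3 → Fin 3 → ℝ) : Prop where
  hasDeriv : ∀ t ∈ Icc 0 T, Tendsto
    (fun s => N (fun x => (s - t)⁻¹ * (u s x - u t x) - ut t x)
      (fun x k => (s - t)⁻¹ * (Du s x k - Du t x k) - Dut t x k))
    (𝓝[Icc 0 T \ {t}] t) (𝓝 0)
  cont_deriv : ∀ t ∈ Icc 0 T, Tendsto
    (fun s => N (fun x => ut s x - ut t x) (fun x k => Dut s x k - Dut t x k))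
    (𝓝[Icc 0 T] t) (𝓝 0)

/-- Admissible test fields for the momentum equation:
`η ∈ C¹([0,T]; H¹_{0,σ}(Ω) ∩ W^{1,∞}(Ω; ℝ³))`, with gradient `Dη`, time derivative `ηt` and
`Dηt = ∇∂ₜη`. -/
structure IsVelocityTest (Ω : Set E3) (T : ℝ) (η : ℝ → E3 → E3) (Dη : ℝ → E3 → Mat3)
    (ηt : ℝ → E3 → E3) (Dηt : ℝ → E3 → Mat3) : Prop where
  mem : ∀ t ∈ Icc 0 T, IsH10SigmaWith Ω (η t) (Dη t)
  mem_deriv : ∀ t ∈ Icc 0 T, IsH10SigmaWith Ω (ηt t) (Dηt t)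
  mem_inf : ∀ t ∈ Icc 0 T, ∀ i, MemLinf Ω (fun x => η t x i) ∧
    ∀ k, MemLinf Ω (fun x => Dη t x i k)
  mem_inf_deriv : ∀ t ∈ Icc 0 T, ∀ i, MemLinf Ω (fun x => ηt t x i) ∧
    ∀ k, MemLinf Ω (fun x => Dηt t x i k)
  c1 : ∀ i, IsC1Curve (fun u Du => h1Norm Ω u Du + w1infNorm Ω u Du) T
    (fun t x => η t x i) (fun t x => Dη t x i) (fun t x => ηt t x i) (fun t x => Dηt t x i)

/-- Admissible test fields for the Q-tensor equation: `Ψ ∈ C¹([0,T]; H¹(Ω; 𝒬))`, where `𝒬` is the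
space of Q-tensors, with gradient `DΨ t x i j k = ∂ₖ Ψᵢⱼ`, time derivative `Ψt` and `DΨt = ∇∂ₜΨ`. -/
structure IsTensorTest (Ω : Set E3) (T : ℝ) (Ψ : ℝ → E3 → Mat3)
    (DΨ : ℝ → E3 → Fin 3 → Fin 3 → Fin 3 → ℝ) (Ψt : ℝ → E3 → Mat3)
    (DΨt : ℝ → E3 → Fin 3 → Fin 3 → Fin 3 → ℝ) : Prop where
  tensor : ∀ t ∈ Icc 0 T, ∀ᵐ x ∂(volume.restrict Ω), Ψ t x ∈ QTensor
  tensor_deriv : ∀ t ∈ Icc 0 T, ∀ᵐ x ∂(volume.restrict Ω), Ψt t x ∈ QTensor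
  mem : ∀ t ∈ Icc 0 T, ∀ i j, IsH1With Ω (fun x => Ψ t x i j) (fun x => DΨ t x i j)
  mem_deriv : ∀ t ∈ Icc 0 T, ∀ i j, IsH1With Ω (fun x => Ψt t x i j) (fun x => DΨt t x i j)
  c1 : ∀ i j, IsC1Curve (h1Norm Ω) T
    (fun t x => Ψ t x i j) (fun t x => DΨ t x i j) (fun t x => Ψt t x i j) (fun t x => DΨt t x i j)

/-! ### Weak solutions of the Beris–Edwards system -/

/-- `(∇Q ⊙ ∇Q)ₖₗ = ∂ₖQ : ∂ₗQ`, in terms of the gradient `D i j k = ∂ₖ Qᵢⱼ` at a point. -/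
def ericksen (D : Fin 3 → Fin 3 → Fin 3 → ℝ) : Mat3 :=
  fun k l => ∑ i, ∑ j, D i j k * D i j l

/-- `|∇Q|²`, in terms of the gradient at a point. -/
def gradSq (D : Fin 3 → Fin 3 → Fin 3 → ℝ) : ℝ := ∑ i, ∑ j, ∑ k, D i j k ^ 2

/-- `(v · ∇) Q`, in terms of the gradient at a point. -/
def advect (v : E3) (D : Fin 3 → Fin 3 → Fin 3 → ℝ) : Mat3 :=
  fun i j => ∑ k, v k * D i j k

/-- `ΔQ`, in terms of the second derivatives at a point. -/
def lap (D2 : Fin 3 → Fin 3 → Fin 3 → Fin 3 → ℝ) : Mat3 :=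
  fun i j => ∑ k, D2 i j k k

/-- The momentum equation on `[0,T]`, tested with `η`. -/
def MomentumIdentity (Ω : Set E3) (ε T : ℝ) (v : ℝ → E3 → E3) (Dv : ℝ → E3 → Mat3)
    (DQ : ℝ → E3 → Fin 3 → Fin 3 → Fin 3 → ℝ)
    (η : ℝ → E3 → E3) (Dη : ℝ → E3 → Mat3) (ηt : ℝ → E3 → E3) : Prop :=
  ((∫ x in Ω, ∑ i, η T x i * v T x i) - ∫ x in Ω, ∑ i, η 0 x i * v 0 x i)
    + (∫ t in (0 : ℝ)..T, ∫ x in Ω,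
        (-(∑ i, ηt t x i * v t x i) - ∑ i, ∑ k, v t x i * v t x k * Dη t x i k))
    + (∫ t in (0 : ℝ)..T, ∫ x in Ω, dot (Dv t x) (Dη t x))
  = ε * ∫ t in (0 : ℝ)..T, ∫ x in Ω, dot (ericksen (DQ t x)) (Dη t x)

/-- The Q-tensor equation on `[0,T]`, tested with `Ψ`. -/
def TensorIdentity (Ω : Set E3) (a b c ε T : ℝ) (v : ℝ → E3 → E3) (Q : ℝ → E3 → Mat3)
    (DQ : ℝ → E3 → Fin 3 → Fin 3 → Fin 3 → ℝ)
    (D2Q : ℝ → E3 → Fin 3 → Fin 3 → Fin 3 → Fin 3 → ℝ)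
    (Ψ Ψt : ℝ → E3 → Mat3) : Prop :=
  ((∫ x in Ω, dot (Q T x) (Ψ T x)) - ∫ x in Ω, dot (Q 0 x) (Ψ 0 x))
    - (∫ t in (0 : ℝ)..T, ∫ x in Ω, dot (Q t x) (Ψt t x))
    + (∫ t in (0 : ℝ)..T, ∫ x in Ω, dot (advect (v t x) (DQ t x)) (Ψ t x))
  = ∫ t in (0 : ℝ)..T, ∫ x in Ω,
      dot (lap (D2Q t x) - (1 / ε ^ 2) • bulkGrad a b c (Q t x)) (Ψ t x)

/-- The total energy `½ ∫ |v|² + ∫ (ε/2 |∇Q|² + ε⁻¹ F_ε(Q))` at time `t`. -/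
def energy (Ω : Set E3) (a b c ε : ℝ) (v : ℝ → E3 → E3) (Q : ℝ → E3 → Mat3)
    (DQ : ℝ → E3 → Fin 3 → Fin 3 → Fin 3 → ℝ) (t : ℝ) : ℝ :=
  1 / 2 * (∫ x in Ω, ‖v t x‖ ^ 2)
    + ∫ x in Ω, (ε / 2 * gradSq (DQ t x) + 1 / ε * bulkReg a b c ε (Q t x))

/-- The energy dissipated on `[0,T]`: `∫∫ |∇v|² + ∫∫ ε⁻¹ |ε ΔQ - ε⁻¹ DF_ε(Q)|²`. -/
def dissipation (Ω : Set E3) (a b c ε : ℝ) (Dv : ℝ → E3 → Mat3) (Q : ℝ → E3 → Mat3)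
    (D2Q : ℝ → E3 → Fin 3 → Fin 3 → Fin 3 → Fin 3 → ℝ) (T : ℝ) : ℝ :=
  (∫ t in (0 : ℝ)..T, ∫ x in Ω, frobNorm (Dv t x) ^ 2)
    + ∫ t in (0 : ℝ)..T, ∫ x in Ω,
        1 / ε * frobNorm (ε • lap (D2Q t x) - (1 / ε) • bulkGrad a b c (Q t x)) ^ 2

/-- `(v, Q)` is a global weak solution on `[0,T₁]` of the Beris–Edwards system in `Ω` with initial
data `(v₀, Q₀)` and homogeneous Dirichlet conditions, the weak derivatives being
`Dv t x i k = ∂ₖ vᵢ`, `DQ t x i j k = ∂ₖ Qᵢⱼ` and `D2Q t x i j k l = ∂ₗ ∂ₖ Qᵢⱼ`. The condition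
`v = 0` on the boundary is contained in `regularity_v`. -/
structure IsWeakSolutionWith (Ω : Set E3) (a b c ε T₁ : ℝ) (v₀ : E3 → E3) (Q₀ : E3 → Mat3)
    (v : ℝ → E3 → E3) (Dv : ℝ → E3 → Mat3) (Q : ℝ → E3 → Mat3)
    (DQ : ℝ → E3 → Fin 3 → Fin 3 → Fin 3 → ℝ)
    (D2Q : ℝ → E3 → Fin 3 → Fin 3 → Fin 3 → Fin 3 → ℝ) : Prop where
  regularity_v : ∀ T ∈ Ioo 0 T₁, IsBCwL2Sigma Ω T v ∧ IsL2H10Sigma Ω T v Dv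
  tensor : ∀ t ∈ Ico 0 T₁, ∀ᵐ x ∂(volume.restrict Ω), Q t x ∈ QTensor
  regularity_Q : ∀ T ∈ Ioo 0 T₁, ∀ i j,
    IsBCwH1 Ω T (fun t x => Q t x i j) (fun t x => DQ t x i j) ∧
    IsL2H2 Ω T (fun t x => Q t x i j) (fun t x => DQ t x i j) (fun t x => D2Q t x i j)
  boundary_Q : ∀ t ∈ Ioo 0 T₁, ∀ i j, IsH10With Ω (fun x => Q t x i j) (fun x => DQ t x i j)
  initial_v : v 0 =ᵐ[volume.restrict Ω] v₀
  initial_Q : Q 0 =ᵐ[volume.restrict Ω] Q₀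
  momentum : ∀ T ∈ Ioo 0 T₁, ∀ η Dη ηt Dηt, IsVelocityTest Ω T η Dη ηt Dηt →
    MomentumIdentity Ω ε T v Dv DQ η Dη ηt
  tensor_eq : ∀ T ∈ Ioo 0 T₁, ∀ Ψ DΨ Ψt DΨt, IsTensorTest Ω T Ψ DΨ Ψt DΨt →
    TensorIdentity Ω a b c ε T v Q DQ D2Q Ψ Ψt
  energy_ineq : ∀ᵐ T ∂(volume.restrict (Ioo 0 T₁)),
    energy Ω a b c ε v Q DQ T + dissipation Ω a b c ε Dv Q D2Q T ≤ energy Ω a b c ε v Q DQ 0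

/-- `(v, Q)` is a global weak solution on `[0,T₁]` of the Beris–Edwards system. -/
def IsWeakSolution (Ω : Set E3) (a b c ε T₁ : ℝ) (v₀ : E3 → E3) (Q₀ : E3 → Mat3)
    (v : ℝ → E3 → E3) (Q : ℝ → E3 → Mat3) : Prop :=
  ∃ Dv DQ D2Q, IsWeakSolutionWith Ω a b c ε T₁ v₀ Q₀ v Dv Q DQ D2Q

end BerisEdwards

end

/-!
Let `G` be a smooth convex function of linear growth on `ℝ⁹` that vanishes exactly on the ball of
radius `c₀`, and test the Q-tensor equation with `∇G(Q)`. The transport term `∫ v · ∇G(Q)` vanishes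
because `v` is solenoidal, the diffusion term `∫ ΔQ : ∇G(Q)` is nonpositive by convexity, and the
reaction term has a sign because `Q : DF(Q) ≥ |Q|² (a - |b| |Q| + c |Q|²) ≥ 0` once `|Q| ≥ c₀`.
Hence `∫ G(Q)` does not increase, and it vanishes initially. As `∇G(Q)` need not be an admissible
test field, the equation is first written in integrated form `Q(T) = Q(0) + ∫₀ᵀ ∂ₜQ` at almost every
point, where the chain rule applies; `∂ₜQ` is integrable since `H¹₀ ⊆ L⁶` controls `DF(Q)`.
-/

noncomputable section

namespace BerisEdwards

section Penalty

/-- A smooth convex primitive of `Real.smoothTransition`, vanishing on `(-∞, 0]`. -/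
def ramp (x : ℝ) : ℝ := ∫ t in (0 : ℝ)..x, Real.smoothTransition t

lemma hasDerivAt_ramp (x : ℝ) : HasDerivAt ramp (Real.smoothTransition x) x :=
  intervalIntegral.integral_hasDerivAt_right
    (Real.smoothTransition.continuous.intervalIntegrable _ _)
    (Real.smoothTransition.continuous.stronglyMeasurableAtFilter _ _)
    Real.smoothTransition.continuous.continuousAt

lemma contDiff_ramp : ContDiff ℝ ∞ ramp := by
  rw [contDiff_infty_iff_deriv, funext fun x => (hasDerivAt_ramp x).deriv]
  exact ⟨fun x => (hasDerivAt_ramp x).differentiableAt, Real.smoothTransition.contDiff⟩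

lemma ramp_of_nonpos {x : ℝ} (hx : x ≤ 0) : ramp x = 0 := by
  rw [ramp, intervalIntegral.integral_congr (g := fun _ => (0 : ℝ)),
    intervalIntegral.integral_zero]
  intro t ht
  rw [uIcc_of_ge hx] at ht
  exact Real.smoothTransition.zero_of_nonpos ht.2

lemma ramp_pos {x : ℝ} (hx : 0 < x) : 0 < ramp x :=
  intervalIntegral.intervalIntegral_pos_of_pos_on
    (Real.smoothTransition.continuous.intervalIntegrable _ _)
    (fun _ ht => Real.smoothTransition.pos_of_pos ht.1) hx

lemma ramp_nonneg (x : ℝ) : 0 ≤ ramp x :=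
  (le_or_gt x 0).elim (fun h => (ramp_of_nonpos h).ge) fun h => (ramp_pos h).le

lemma exists_abs_deriv_smoothTransition_le :
    ∃ C : ℝ, ∀ x, |deriv Real.smoothTransition x| ≤ C := by
  have hcont : Continuous (deriv Real.smoothTransition) :=
    (Real.smoothTransition.contDiff (n := 1)).continuous_deriv le_rfl
  refine hcont.bounded_above_of_compact_support <|
    HasCompactSupport.intro (isCompact_Icc (a := (0 : ℝ)) (b := 1)) fun x hx => ?_
  rw [mem_Icc, not_and_or, not_le, not_le] at hx
  rcases hx with h | h
  · have : Real.smoothTransition =ᶠ[𝓝 x] fun _ => 0 := by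
      filter_upwards [Iio_mem_nhds h] with y hy
      exact Real.smoothTransition.zero_of_nonpos (le_of_lt hy)
    rw [this.deriv_eq, deriv_const]
  · have : Real.smoothTransition =ᶠ[𝓝 x] fun _ => 1 := by
      filter_upwards [Ioi_mem_nhds h] with y hy
      exact Real.smoothTransition.one_of_one_le (le_of_lt hy)
    rw [this.deriv_eq, deriv_const]

variable {E : Type*} [NormedAddCommGroup E]

/-- The Japanese bracket `√(1 + |y|²)`, a smooth substitute for the norm. -/
def bracket (y : E) : ℝ := Real.sqrt (1 + ‖y‖ ^ 2)

lemma bracket_pos (y : E) : 0 < bracket y := Real.sqrt_pos.2 (by positivity)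

lemma one_le_bracket (y : E) : 1 ≤ bracket y :=
  Real.one_le_sqrt.2 (le_add_of_nonneg_right (sq_nonneg _))

lemma norm_le_bracket (y : E) : ‖y‖ ≤ bracket y := Real.le_sqrt_of_sq_le (by linarith)

lemma bracket_le_sqrt_iff {c₀ : ℝ} (hc₀ : 0 ≤ c₀) (y : E) :
    bracket y ≤ Real.sqrt (1 + c₀ ^ 2) ↔ ‖y‖ ≤ c₀ := by
  rw [bracket, Real.sqrt_le_sqrt_iff (by positivity), add_le_add_iff_left,
    sq_le_sq₀ (norm_nonneg _) hc₀]

/-- The penalty `ramp (√(1 + |y|²) - √(1 + c₀²))`: smooth, convex, of linear growth, and vanishing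
exactly on the ball of radius `c₀`. -/
def penalty (c₀ : ℝ) (y : E) : ℝ := ramp (bracket y - Real.sqrt (1 + c₀ ^ 2))

lemma penalty_nonneg (c₀ : ℝ) (y : E) : 0 ≤ penalty c₀ y := ramp_nonneg _

lemma penalty_eq_zero_iff {c₀ : ℝ} (hc₀ : 0 ≤ c₀) {y : E} : penalty c₀ y = 0 ↔ ‖y‖ ≤ c₀ := by
  rw [← bracket_le_sqrt_iff hc₀]
  refine ⟨fun h => ?_, fun h => ramp_of_nonpos (sub_nonpos.2 h)⟩
  by_contra hlt
  exact (ramp_pos (sub_pos.2 (not_le.1 hlt))).ne' h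

variable [InnerProductSpace ℝ E]

/-- The gradient `y / √(1 + |y|²)` of the bracket. -/
def bracketGrad (y : E) : E := (bracket y)⁻¹ • y

lemma norm_bracketGrad_le_one (y : E) : ‖bracketGrad y‖ ≤ 1 := by
  rw [bracketGrad, norm_smul, norm_inv, Real.norm_of_nonneg (bracket_pos y).le,
    inv_mul_le_one₀ (bracket_pos y)]
  exact norm_le_bracket y

lemma contDiff_bracket : ContDiff ℝ ∞ (bracket : E → ℝ) :=
  (contDiff_const.add (contDiff_norm_sq ℝ)).sqrt fun _ => by positivity

lemma hasFDerivAt_bracket (y : E) : HasFDerivAt bracket (innerSL ℝ (bracketGrad y)) y := by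
  refine (((hasStrictFDerivAt_norm_sq y).hasFDerivAt.const_add 1).sqrt
    (by positivity)).congr_fderiv ?_
  rw [← bracket, bracketGrad, map_smul, ← Nat.cast_smul_eq_nsmul ℝ 2, smul_smul]
  congr 1
  push_cast
  field_simp

lemma contDiff_bracketGrad : ContDiff ℝ ∞ (bracketGrad : E → E) :=
  (contDiff_bracket.inv fun y => (bracket_pos y).ne').smul contDiff_id

lemma fderiv_bracketGrad_apply (y h : E) :
    fderiv ℝ bracketGrad y h
      = (bracket y)⁻¹ • (h - inner ℝ (bracketGrad y) h • bracketGrad y) := by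
  have hinv := (hasDerivAt_inv (bracket_pos y).ne').comp_hasFDerivAt y (hasFDerivAt_bracket y)
  have hdir : HasFDerivAt bracketGrad _ y := hinv.smul (hasFDerivAt_id y)
  rw [hdir.fderiv]
  simp only [bracketGrad, add_apply, smul_apply, ContinuousLinearMap.smulRight_apply,
    ContinuousLinearMap.id_apply, innerSL_apply_apply, Function.comp_apply, smul_eq_mul]
  module

variable (c₀ : ℝ)

/-- The gradient of the penalty. -/
def penaltyGrad (y : E) : E :=
  Real.smoothTransition (bracket y - Real.sqrt (1 + c₀ ^ 2)) • bracketGrad y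

lemma hasFDerivAt_penalty (y : E) :
    HasFDerivAt (penalty c₀) (innerSL ℝ (penaltyGrad c₀ y)) y := by
  rw [penaltyGrad, map_smul]
  exact (hasDerivAt_ramp _).comp_hasFDerivAt y ((hasFDerivAt_bracket y).sub_const _)

lemma contDiff_penalty : ContDiff ℝ ∞ (penalty c₀ : E → ℝ) :=
  contDiff_ramp.comp (contDiff_bracket.sub contDiff_const)

lemma norm_penaltyGrad_le_one (y : E) : ‖penaltyGrad c₀ y‖ ≤ 1 := by
  rw [penaltyGrad, norm_smul, Real.norm_of_nonneg (Real.smoothTransition.nonneg _)]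
  exact mul_le_one₀ (Real.smoothTransition.le_one _) (norm_nonneg _) (norm_bracketGrad_le_one y)

lemma lipschitzWith_penalty : LipschitzWith 1 (penalty c₀ : E → ℝ) := by
  refine lipschitzWith_of_nnnorm_fderiv_le
    (fun y => (hasFDerivAt_penalty c₀ y).differentiableAt) fun y => ?_
  rw [(hasFDerivAt_penalty c₀ y).fderiv, ← NNReal.coe_le_coe, coe_nnnorm, innerSL_apply_norm]
  exact norm_penaltyGrad_le_one c₀ y

lemma contDiff_penaltyGrad : ContDiff ℝ ∞ (penaltyGrad c₀ : E → E) :=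
  (Real.smoothTransition.contDiff.comp (contDiff_bracket.sub contDiff_const)).smul
    contDiff_bracketGrad

lemma penaltyGrad_of_norm_le {c₀ : ℝ} (hc₀ : 0 ≤ c₀) {y : E} (hy : ‖y‖ ≤ c₀) :
    penaltyGrad c₀ y = 0 := by
  rw [penaltyGrad, Real.smoothTransition.zero_of_nonpos
    (sub_nonpos.2 ((bracket_le_sqrt_iff hc₀ y).2 hy)), zero_smul]

lemma exists_penaltyGrad_eq_smul (y : E) : ∃ m : ℝ, 0 ≤ m ∧ penaltyGrad c₀ y = m • y :=
  ⟨_, mul_nonneg (Real.smoothTransition.nonneg _) (inv_nonneg.2 (bracket_pos y).le),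
    smul_smul _ _ _⟩

lemma fderiv_penaltyGrad_apply (y h : E) :
    fderiv ℝ (penaltyGrad c₀) y h
      = (deriv Real.smoothTransition (bracket y - Real.sqrt (1 + c₀ ^ 2))
            * inner ℝ (bracketGrad y) h) • bracketGrad y
        + (Real.smoothTransition (bracket y - Real.sqrt (1 + c₀ ^ 2)) / bracket y)
            • (h - inner ℝ (bracketGrad y) h • bracketGrad y) := by
  have hτ : HasDerivAt Real.smoothTransition _ (bracket y - Real.sqrt (1 + c₀ ^ 2)) :=
    ((Real.smoothTransition.contDiff (n := 1)).differentiable one_ne_zero _).hasDerivAt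
  have hcoef := hτ.comp_hasFDerivAt y ((hasFDerivAt_bracket y).sub_const (Real.sqrt (1 + c₀ ^ 2)))
  have hdir := (contDiff_bracketGrad.differentiable (by simp) y).hasFDerivAt
  have hgrad : HasFDerivAt (penaltyGrad c₀) _ y := hcoef.smul hdir
  rw [hgrad.fderiv]
  simp only [add_apply, smul_apply, ContinuousLinearMap.smulRight_apply, innerSL_apply_apply,
    Function.comp_apply, smul_eq_mul, fderiv_bracketGrad_apply, smul_smul, div_eq_mul_inv]
  exact add_comm _ _

lemma inner_fderiv_penaltyGrad_nonneg (y h : E) :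
    0 ≤ inner ℝ (fderiv ℝ (penaltyGrad c₀) y h) h := by
  have hcs : inner ℝ (bracketGrad y) h ^ 2 ≤ ‖h‖ ^ 2 := by
    refine sq_le_sq.2 ((abs_real_inner_le_norm _ _).trans ?_)
    rw [abs_norm]
    exact mul_le_of_le_one_left (norm_nonneg h) (norm_bracketGrad_le_one y)
  have hτ' := (Real.smoothTransition.monotone).deriv_nonneg
    (x := bracket y - Real.sqrt (1 + c₀ ^ 2))
  have hτ := div_nonneg (Real.smoothTransition.nonneg (bracket y - Real.sqrt (1 + c₀ ^ 2)))
    (bracket_pos y).le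
  rw [fderiv_penaltyGrad_apply, inner_add_left, real_inner_smul_left, real_inner_smul_left,
    inner_sub_left, real_inner_smul_left, real_inner_self_eq_norm_sq]
  nlinarith [mul_nonneg hτ' (sq_nonneg (inner ℝ (bracketGrad y) h)),
    mul_nonneg hτ (sub_nonneg.2 hcs)]

lemma exists_norm_fderiv_penaltyGrad_le : ∃ C : ℝ, ∀ y : E, ‖fderiv ℝ (penaltyGrad c₀) y‖ ≤ C := by
  obtain ⟨C, hC⟩ := exists_abs_deriv_smoothTransition_le
  have hC₀ : 0 ≤ C := (abs_nonneg _).trans (hC 0)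
  refine ⟨C + 2, fun y => ContinuousLinearMap.opNorm_le_bound _ (by positivity) fun h => ?_⟩
  have hproj : ‖inner ℝ (bracketGrad y) h • bracketGrad y‖ ≤ ‖h‖ := by
    have he := norm_bracketGrad_le_one y
    calc _ ≤ (‖bracketGrad y‖ * ‖h‖) * ‖bracketGrad y‖ := by
          rw [norm_smul]; gcongr; exact norm_inner_le_norm _ _
      _ ≤ (1 * ‖h‖) * 1 := by gcongr
      _ = ‖h‖ := by ring
  have hτ : ‖Real.smoothTransition (bracket y - Real.sqrt (1 + c₀ ^ 2)) / bracket y‖ ≤ 1 := by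
    rw [Real.norm_of_nonneg (div_nonneg (Real.smoothTransition.nonneg _) (bracket_pos y).le),
      div_le_one (bracket_pos y)]
    exact (Real.smoothTransition.le_one _).trans (one_le_bracket y)
  rw [fderiv_penaltyGrad_apply, mul_smul]
  calc _ ≤ C * ‖h‖ + 1 * (‖h‖ + ‖h‖) := by
        refine norm_add_le_of_le
          ((norm_smul_le _ _).trans (mul_le_mul (hC _) hproj (norm_nonneg _) hC₀))
          ((norm_smul_le _ _).trans (mul_le_mul hτ ?_ (norm_nonneg _) zero_le_one))
        exact (norm_sub_le _ _).trans (by gcongr)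
    _ = (C + 2) * ‖h‖ := by ring

end Penalty

section ChainRule

lemma ae_prod_of_ae_ae {X Y : Type*} [MeasurableSpace X] [MeasurableSpace Y] {μ : Measure X}
    {ν : Measure Y} [SFinite μ] [SFinite ν] {p : X × Y → Prop}
    (hp : NullMeasurableSet {z | p z} (μ.prod ν)) (h : ∀ᵐ y ∂ν, ∀ᵐ x ∂μ, p (x, y)) :
    ∀ᵐ z ∂μ.prod ν, p z := by
  obtain ⟨t, htm, hpt⟩ := hp
  have hslice : ∀ᵐ y ∂ν, ∀ᵐ x ∂μ, (x, y) ∈ {z | p z} ↔ (x, y) ∈ t :=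
    Measure.ae_ae_of_ae_prod (μ := ν) (ν := μ)
      (p := fun z : Y × X => (z.2, z.1) ∈ {z | p z} ↔ (z.2, z.1) ∈ t)
      (Measure.measurePreserving_swap.quasiMeasurePreserving.ae hpt.mem_iff)
  have ht : ∀ᵐ x ∂μ, ∀ᵐ y ∂ν, (x, y) ∈ t := by
    rw [Measure.ae_ae_comm (p := fun x y => (x, y) ∈ t) htm]
    filter_upwards [h, hslice] with y hy hyt
    filter_upwards [hy, hyt] with x hx hxt using hxt.1 hx
  filter_upwards [(Measure.ae_prod_mem_iff_ae_ae_mem htm).2 ht, hpt.mem_iff] with z hz hpz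
  exact hpz.2 hz

lemma absolutelyContinuousOnInterval_of_dist_le_mul {X Y : Type*} [PseudoMetricSpace X]
    [PseudoMetricSpace Y] {f : ℝ → X} {g : ℝ → Y} {a b K : ℝ}
    (hg : AbsolutelyContinuousOnInterval g a b)
    (h : ∀ s ∈ uIcc a b, ∀ t ∈ uIcc a b, dist (f s) (f t) ≤ K * dist (g s) (g t)) :
    AbsolutelyContinuousOnInterval f a b := by
  unfold AbsolutelyContinuousOnInterval at hg ⊢
  refine squeeze_zero' (.of_forall fun I => Finset.sum_nonneg fun _ _ => dist_nonneg) ?_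
    (by simpa using hg.const_mul K)
  rw [eventually_inf_principal]
  filter_upwards with I hI
  rw [Finset.mul_sum]
  exact Finset.sum_le_sum fun i hi => h _ (hI.1 i hi).1 _ (hI.1 i hi).2

variable {X : Type*} [MeasurableSpace X] {μ : Measure X}
  {E : Type*} [NormedAddCommGroup E] [NormedSpace ℝ E] {T : ℝ}

lemma aestronglyMeasurable_integral_zero_to [SFinite μ] {g : X × ℝ → E}
    (hg : AEStronglyMeasurable g (μ.prod (volume.restrict (Ioo 0 T)))) :
    AEStronglyMeasurable (fun p : X × ℝ => ∫ s in (0 : ℝ)..p.2, g (p.1, s))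
      (μ.prod (volume.restrict (Ioo 0 T))) := by
  have hle : MeasurableSet {q : (X × ℝ) × ℝ | q.2 ≤ q.1.2} :=
    measurableSet_le measurable_snd (measurable_snd.comp measurable_fst)
  have hmk : StronglyMeasurable fun q : (X × ℝ) × ℝ => hg.mk g (q.1.1, q.2) :=
    hg.stronglyMeasurable_mk.comp_measurable
      ((measurable_fst.comp measurable_fst).prodMk measurable_snd)
  refine (hmk.indicator hle).integral_prod_right'
    (ν := volume.restrict (Ioo 0 T)) |>.aestronglyMeasurable.congr ?_
  filter_upwards [Measure.quasiMeasurePreserving_fst.ae (Measure.ae_ae_of_ae_prod hg.ae_eq_mk),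
    Measure.quasiMeasurePreserving_snd.ae (ae_restrict_mem measurableSet_Ioo)] with p hgp hp
  have hIoc : Ioo 0 T ∩ Iic p.2 = Ioc 0 p.2 := by
    ext s
    exact ⟨fun hs => ⟨hs.1.1, hs.2⟩, fun hs => ⟨⟨hs.1, hs.2.trans_lt hp.2⟩, hs.2⟩⟩
  calc _ = ∫ s in Ioo 0 T, (Iic p.2).indicator (fun s => hg.mk g (p.1, s)) s := rfl
    _ = ∫ s in Ioc 0 p.2, hg.mk g (p.1, s) := by
      rw [setIntegral_indicator measurableSet_Iic, hIoc]
    _ = ∫ s in (0 : ℝ)..p.2, g (p.1, s) := by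
      rw [intervalIntegral.integral_of_le hp.1.le]
      exact integral_congr_ae (ae_restrict_of_ae_restrict_of_subset
        (hIoc ▸ inter_subset_left) (hgp.mono fun s hs => hs.symm))

variable [CompleteSpace E] {K : NNReal} {Φ : E → ℝ}

lemma sub_eq_integral_fderiv_comp_integral (hΦ : LipschitzWith K Φ) (hd : Differentiable ℝ Φ)
    {g : ℝ → E} (hg : IntervalIntegrable g volume 0 T) (y : E) :
    Φ (y + ∫ s in (0 : ℝ)..T, g s) - Φ y
      = ∫ t in (0 : ℝ)..T, fderiv ℝ Φ (y + ∫ s in (0 : ℝ)..t, g s) (g t) := by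
  have hac : AbsolutelyContinuousOnInterval (fun t => ∫ s in (0 : ℝ)..t, ‖g s‖) 0 T :=
    hg.norm.absolutelyContinuousOnInterval_intervalIntegral left_mem_uIcc
  have hsub : ∀ s ∈ uIcc 0 T, IntervalIntegrable g volume 0 s := fun s hs =>
    hg.mono_set (uIcc_subset_uIcc_left hs)
  have hac' : AbsolutelyContinuousOnInterval (fun t => Φ (y + ∫ s in (0 : ℝ)..t, g s)) 0 T := by
    refine absolutelyContinuousOnInterval_of_dist_le_mul hac fun s hs t ht =>
      (hΦ.dist_le_mul _ _).trans (mul_le_mul_of_nonneg_left ?_ K.2)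
    rw [dist_add_left, dist_eq_norm, dist_eq_norm,
      intervalIntegral.integral_interval_sub_left (hsub s hs) (hsub t ht),
      intervalIntegral.integral_interval_sub_left (hsub s hs).norm (hsub t ht).norm]
    exact intervalIntegral.norm_integral_le_abs_integral_norm
  have hftc := hac'.integral_deriv_eq_sub
  simp only [intervalIntegral.integral_same, add_zero] at hftc
  rw [← hftc]
  refine intervalIntegral.integral_congr_ae ?_
  filter_upwards [hg.ae_hasDerivAt_integral] with t ht htT
  have hderiv := ht (uIoc_subset_uIcc htT) 0 (by simp)
  exact ((hd _).hasFDerivAt.comp_hasDerivAt t (hderiv.const_add y)).deriv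

variable [SFinite μ] {u : ℝ → X → E} {g : X × ℝ → E}

lemma ae_sub_eq_integral_fderiv (hT : 0 < T)
    (hu : AEStronglyMeasurable (fun p : X × ℝ => u p.2 p.1) (μ.prod (volume.restrict (Ioo 0 T))))
    (hu₀ : AEStronglyMeasurable (u 0) μ) (hg : Integrable g (μ.prod (volume.restrict (Ioo 0 T))))
    (h : ∀ t ∈ Ioc 0 T, ∀ᵐ x ∂μ, u t x = u 0 x + ∫ s in (0 : ℝ)..t, g (x, s))
    (hΦ : LipschitzWith K Φ) (hd : Differentiable ℝ Φ) :
    ∀ᵐ x ∂μ, Φ (u T x) - Φ (u 0 x) = ∫ t in Ioo 0 T, fderiv ℝ Φ (u t x) (g (x, t)) := by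
  have hslice : ∀ᵐ p ∂μ.prod (volume.restrict (Ioo 0 T)),
      u p.2 p.1 = u 0 p.1 + ∫ s in (0 : ℝ)..p.2, g (p.1, s) := by
    refine ae_prod_of_ae_ae
      (hu.nullMeasurableSet_eq_fun (hu₀.comp_fst.add (aestronglyMeasurable_integral_zero_to hg.1)))
      ?_
    filter_upwards [ae_restrict_mem measurableSet_Ioo] with t ht using h t (Ioo_subset_Ioc_self ht)
  filter_upwards [Measure.ae_ae_of_ae_prod hslice, hg.prod_right_ae, h T ⟨hT, le_rfl⟩]
    with x hx hgx huT
  have hgi : IntervalIntegrable (fun s => g (x, s)) volume 0 T :=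
    (intervalIntegrable_iff_integrableOn_Ioo_of_le hT.le).2 hgx
  rw [huT, sub_eq_integral_fderiv_comp_integral hΦ hd hgi, intervalIntegral.integral_of_le hT.le,
    integral_Ioc_eq_integral_Ioo]
  exact integral_congr_ae (hx.mono fun t ht => by simp only [ht])

/-- A Lyapunov argument: `∫ Φ(u(t))` starts at zero and does not increase. -/
lemma ae_eq_zero_of_integral_fderiv_nonpos (hT : 0 < T)
    (hu : AEStronglyMeasurable (fun p : X × ℝ => u p.2 p.1) (μ.prod (volume.restrict (Ioo 0 T))))
    (hu₀ : AEStronglyMeasurable (u 0) μ) (hg : Integrable g (μ.prod (volume.restrict (Ioo 0 T))))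
    (h : ∀ t ∈ Ioc 0 T, ∀ᵐ x ∂μ, u t x = u 0 x + ∫ s in (0 : ℝ)..t, g (x, s))
    (hΦ : LipschitzWith K Φ) (hd : ContDiff ℝ 1 Φ) (hnonneg : ∀ y, 0 ≤ Φ y)
    (hinit : ∀ᵐ x ∂μ, Φ (u 0 x) = 0)
    (hdecr : ∀ᵐ t ∂volume.restrict (Ioo 0 T), ∫ x, fderiv ℝ Φ (u t x) (g (x, t)) ∂μ ≤ 0) :
    ∀ᵐ x ∂μ, Φ (u T x) = 0 := by
  have hderiv_int : Integrable (fun p : X × ℝ => fderiv ℝ Φ (u p.2 p.1) (g p))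
      (μ.prod (volume.restrict (Ioo 0 T))) := by
    refine (hg.norm.const_mul (K : ℝ)).mono' ?_ (.of_forall fun p => ?_)
    · exact isBoundedBilinearMap_apply.continuous.comp_aestronglyMeasurable
        (((hd.continuous_fderiv one_ne_zero).comp_aestronglyMeasurable hu).prodMk hg.1)
    · exact ContinuousLinearMap.le_of_opNorm_le _ (norm_fderiv_le_of_lipschitz ℝ hΦ) _
  have hchain : ∀ᵐ x ∂μ, Φ (u T x) = ∫ t in Ioo 0 T, fderiv ℝ Φ (u t x) (g (x, t)) := by
    filter_upwards [ae_sub_eq_integral_fderiv hT hu hu₀ hg h hΦ (hd.differentiable one_ne_zero),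
      hinit] with x hx hx₀
    rw [← hx, hx₀, sub_zero]
  have hint : Integrable (fun x => Φ (u T x)) μ :=
    hderiv_int.integral_prod_left.congr (hchain.mono fun x hx => hx.symm)
  have hle : ∫ x, Φ (u T x) ∂μ ≤ 0 := by
    rw [integral_congr_ae hchain, integral_integral_swap hderiv_int]
    exact integral_nonpos_of_ae hdecr
  exact (integral_eq_zero_iff_of_nonneg (fun x => hnonneg _) hint).1
    (hle.antisymm (integral_nonneg fun x => hnonneg _))

end ChainRule

section Convergence

variable {X : Type*} [MeasurableSpace X] {μ : Measure X} {p : ℝ≥0∞}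
  {E : Type*} [NormedAddCommGroup E]

lemma tendsto_eLpNorm_zero_of_dominated (hp₀ : p ≠ 0) (hp : p ≠ ⊤) {f : ℕ → X → E} {b : X → ℝ}
    (hf : ∀ n, AEStronglyMeasurable (f n) μ) (hb : MemLp b p μ)
    (hbound : ∀ n, ∀ᵐ x ∂μ, ‖f n x‖ ≤ b x)
    (hlim : ∀ᵐ x ∂μ, Tendsto (fun n => f n x) atTop (𝓝 0)) :
    Tendsto (fun n => eLpNorm (f n) p μ) atTop (𝓝 0) := by
  have hp_pos : 0 < p.toReal := ENNReal.toReal_pos hp₀ hp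
  have hint : Tendsto (fun n => ∫⁻ x, ‖f n x‖ₑ ^ p.toReal ∂μ) atTop (𝓝 0) := by
    rw [← lintegral_zero (μ := μ)]
    refine tendsto_lintegral_of_dominated_convergence' (fun x => ‖b x‖ₑ ^ p.toReal)
      (fun n => (hf n).enorm.pow_const _) (fun n => ?_)
      (lintegral_rpow_enorm_lt_top_of_eLpNorm_lt_top hp₀ hp hb.2).ne ?_
    · filter_upwards [hbound n] with x hx
      gcongr
      exact enorm_le_iff_norm_le.2 (hx.trans (le_abs_self _))
    · filter_upwards [hlim] with x hx
      simpa [hp_pos, Function.comp_def] using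
        (ENNReal.continuous_rpow_const (y := p.toReal)).tendsto _ |>.comp hx.enorm
  simpa [eLpNorm_eq_lintegral_rpow_enorm_toReal hp₀ hp, hp_pos, Function.comp_def] using
    (ENNReal.continuous_rpow_const (y := 1 / p.toReal)).tendsto 0 |>.comp hint

lemma eLpNorm_le_sum_eLpNorm_apply {ι : Type*} [Fintype ι] {f : X → EuclideanSpace ℝ ι}
    (hf : ∀ i, AEStronglyMeasurable (fun x => f x i) μ) (hp : 1 ≤ p) :
    eLpNorm f p μ ≤ ∑ i, eLpNorm (fun x => f x i) p μ := by
  classical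
  calc eLpNorm f p μ = eLpNorm (∑ i, fun x => EuclideanSpace.single i (f x i)) p μ := by
        congr 1
        ext x j
        simp [Finset.sum_apply]
    _ ≤ ∑ i, eLpNorm (fun x => EuclideanSpace.single i (f x i)) p μ :=
        eLpNorm_sum_le (fun i _ => ((PiLp.continuous_toLp 2 _).comp
          (continuous_single i)).comp_aestronglyMeasurable (hf i)) hp
    _ = ∑ i, eLpNorm (fun x => f x i) p μ :=
        Finset.sum_congr rfl fun i _ => eLpNorm_congr_norm_ae (.of_forall fun x => by simp)

lemma tendsto_eLpNorm_zero_of_apply {ι : Type*} [Fintype ι] {f : ℕ → X → EuclideanSpace ℝ ι}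
    (hf : ∀ n i, AEStronglyMeasurable (fun x => f n x i) μ) (hp : 1 ≤ p)
    (h : ∀ i, Tendsto (fun n => eLpNorm (fun x => f n x i) p μ) atTop (𝓝 0)) :
    Tendsto (fun n => eLpNorm (f n) p μ) atTop (𝓝 0) :=
  tendsto_nhds_bot_mono' (by simpa using tendsto_finsetSum Finset.univ fun i _ => h i)
    fun n => eLpNorm_le_sum_eLpNorm_apply (hf n) hp

lemma tendsto_eLpNorm_zero_of_norm_le_mul {F : Type*} [NormedAddCommGroup F] {f : ℕ → X → F}
    {g : ℕ → X → E} {K : NNReal} (h : Tendsto (fun n => eLpNorm (g n) p μ) atTop (𝓝 0))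
    (hfg : ∀ n x, ‖f n x‖ ≤ K * ‖g n x‖) : Tendsto (fun n => eLpNorm (f n) p μ) atTop (𝓝 0) := by
  have hscaled : Tendsto (fun n => K * eLpNorm (g n) p μ) atTop (𝓝 0) := by
    simpa using ENNReal.Tendsto.const_mul h (.inr ENNReal.coe_ne_top)
  exact tendsto_nhds_bot_mono' hscaled fun n =>
    eLpNorm_le_nnreal_smul_eLpNorm_of_ae_le_mul (.of_forall (hfg n)) p

lemma tendsto_integral_mul_of_tendsto_eLpNorm {u f : X → ℝ} {φ : ℕ → X → ℝ} (hu : MemLp u 2 μ)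
    (hφ : ∀ n, MemLp (φ n) 2 μ) (hf : MemLp f 2 μ)
    (h : Tendsto (fun n => eLpNorm (fun x => u x - φ n x) 2 μ) atTop (𝓝 0)) :
    Tendsto (fun n => ∫ x, φ n x * f x ∂μ) atTop (𝓝 (∫ x, u x * f x ∂μ)) := by
  refine tendsto_integral_of_L1' _ (hu.integrable_mul hf).1
    (.of_forall fun n => (hφ n).integrable_mul hf) ?_
  have hlim : Tendsto (fun n => eLpNorm (fun x => u x - φ n x) 2 μ * eLpNorm f 2 μ) atTop
      (𝓝 0) := by
    simpa using ENNReal.Tendsto.mul_const h (.inr hf.2.ne)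
  refine tendsto_nhds_bot_mono' hlim fun n => ?_
  calc eLpNorm ((fun x => φ n x * f x) - fun x => u x * f x) 1 μ
      = eLpNorm ((fun x => u x - φ n x) • f) 1 μ :=
        eLpNorm_congr_norm_ae (.of_forall fun x => by
          rw [Pi.sub_apply, Pi.smul_apply', smul_eq_mul, ← sub_mul, norm_mul, norm_mul,
            norm_sub_rev])
    _ ≤ eLpNorm (fun x => u x - φ n x) 2 μ * eLpNorm f 2 μ :=
        eLpNorm_smul_le_mul_eLpNorm hf.1 (hu.1.sub (hφ n).1)

lemma tendsto_eLpNorm_clm_apply_sub {F : Type*} [NormedAddCommGroup F] [NormedSpace ℝ E]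
    [NormedSpace ℝ F] (hp₁ : 1 ≤ p) (hp : p ≠ ⊤) {A : X → E →L[ℝ] F} {A' : ℕ → X → E →L[ℝ] F}
    {g : X → E} {g' : ℕ → X → E} {K : NNReal} (hA : AEStronglyMeasurable A μ)
    (hA' : ∀ n, AEStronglyMeasurable (A' n) μ) (hK : ∀ x, ‖A x‖ ≤ K) (hK' : ∀ n x, ‖A' n x‖ ≤ K)
    (hlim : ∀ᵐ x ∂μ, Tendsto (fun n => A' n x) atTop (𝓝 (A x)))
    (hg : MemLp g p μ) (hg' : ∀ n, AEStronglyMeasurable (g' n) μ)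
    (h : Tendsto (fun n => eLpNorm (g - g' n) p μ) atTop (𝓝 0)) :
    Tendsto (fun n => eLpNorm (fun x => A x (g x) - A' n x (g' n x)) p μ) atTop (𝓝 0) := by
  have hcont : Continuous fun q : (E →L[ℝ] F) × E => q.1 q.2 :=
    isBoundedBilinearMap_apply.continuous
  have hsub_meas : ∀ n, AEStronglyMeasurable (fun x => (A x - A' n x) (g x)) μ := fun n =>
    hcont.comp_aestronglyMeasurable ((hA.sub (hA' n)).prodMk hg.1)
  have hconv_meas : ∀ n, AEStronglyMeasurable (fun x => A' n x ((g - g' n) x)) μ := fun n =>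
    hcont.comp_aestronglyMeasurable ((hA' n).prodMk (hg.1.sub (hg' n)))
  have hoperator : Tendsto (fun n => eLpNorm (fun x => (A x - A' n x) (g x)) p μ) atTop (𝓝 0) := by
    refine tendsto_eLpNorm_zero_of_dominated (by positivity) hp hsub_meas
      (hg.norm.const_mul (K + K : ℝ)) (fun n => .of_forall fun x => ?_) ?_
    · exact (A x - A' n x).le_of_opNorm_le
        ((norm_sub_le _ _).trans (add_le_add (hK x) (hK' n x))) _
    · filter_upwards [hlim] with x hx
      simpa [Function.comp_def] using (hcont.tendsto (A x - A x, g x)).comp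
        ((hx.const_sub (A x)).prodMk_nhds tendsto_const_nhds)
  have hargument : Tendsto (fun n => eLpNorm (fun x => A' n x ((g - g' n) x)) p μ)
      atTop (𝓝 0) :=
    tendsto_eLpNorm_zero_of_norm_le_mul h fun n x => (A' n x).le_of_opNorm_le (hK' n x) _
  have hsum := hoperator.add hargument
  rw [add_zero] at hsum
  refine tendsto_nhds_bot_mono' hsum fun n => ?_
  have hsplit : (fun x => A x (g x) - A' n x (g' n x))
      = (fun x => (A x - A' n x) (g x)) + fun x => A' n x ((g - g' n) x) := by
    ext x
    simp
  rw [hsplit]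
  exact eLpNorm_add_le (hsub_meas n) (hconv_meas n) hp₁

end Convergence

section Sobolev

variable {Ω : Set E3} {ι : Type*} [Fintype ι]

lemma IsTestFunction.continuous_pderiv {φ : E3 → ℝ} (hφ : IsTestFunction Ω φ) (k : Fin 3) :
    Continuous (pderiv k φ) :=
  (hφ.smooth.continuous_fderiv (by simp)).clm_apply continuous_const

lemma IsTestFunction.hasCompactSupport_pderiv {φ : E3 → ℝ} (hφ : IsTestFunction Ω φ) (k : Fin 3) :
    HasCompactSupport (pderiv k φ) :=
  (hφ.compact.fderiv ℝ).comp_left (g := fun L : E3 →L[ℝ] ℝ => L (EuclideanSpace.single k 1)) rfl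

lemma IsTestFunction.eq_zero_of_notMem {φ : E3 → ℝ} (hφ : IsTestFunction Ω φ) {x : E3}
    (hx : x ∉ Ω) : φ x = 0 :=
  image_eq_zero_of_notMem_tsupport fun h => hx (hφ.subset h)

lemma IsTestFunction.isH1With {φ : E3 → ℝ} (hφ : IsTestFunction Ω φ) :
    IsH1With Ω φ (fun x k => pderiv k φ x) where
  mem := (hφ.smooth.continuous.memLp_of_hasCompactSupport hφ.compact).restrict Ω
  mem_grad k := ((hφ.continuous_pderiv k).memLp_of_hasCompactSupport
    (hφ.hasCompactSupport_pderiv k)).restrict Ω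
  weak k := by
    refine ⟨hφ.smooth.continuous.locallyIntegrable.locallyIntegrableOn Ω,
      (hφ.continuous_pderiv k).locallyIntegrable.locallyIntegrableOn Ω, fun ψ hψ => ?_⟩
    rw [setIntegral_eq_integral_of_forall_compl_eq_zero fun x hx => by
        rw [hφ.eq_zero_of_notMem hx, zero_mul],
      setIntegral_eq_integral_of_forall_compl_eq_zero fun x hx => by
        rw [hψ.eq_zero_of_notMem hx, mul_zero]]
    exact integral_mul_fderiv_eq_neg_fderiv_mul_of_integrable
      (((hφ.continuous_pderiv k).mul hψ.smooth.continuous).integrable_of_hasCompactSupport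
        hψ.compact.mul_left)
      ((hφ.smooth.continuous.mul (hψ.continuous_pderiv k)).integrable_of_hasCompactSupport
        hφ.compact.mul_right)
      ((hφ.smooth.continuous.mul hψ.smooth.continuous).integrable_of_hasCompactSupport
        hφ.compact.mul_right)
      (fun x _ => hφ.smooth.differentiable (by simp) x)
      (fun x _ => hψ.smooth.differentiable (by simp) x)

section Approximation

variable {u : E3 → ℝ} {Du : E3 → Fin 3 → ℝ} {φ : ℕ → E3 → ℝ}

lemma tendsto_eLpNorm_of_tendsto_h1Norm
    (h : Tendsto (fun n => h1Norm Ω (fun x => u x - φ n x) (fun x k => Du x k - pderiv k (φ n) x))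
      atTop (𝓝 0)) :
    Tendsto (fun n => eLpNorm (fun x => u x - φ n x) 2 (volume.restrict Ω)) atTop (𝓝 0) :=
  tendsto_nhds_bot_mono' h fun _ => le_self_add

lemma tendsto_eLpNorm_grad_of_tendsto_h1Norm
    (h : Tendsto (fun n => h1Norm Ω (fun x => u x - φ n x) (fun x k => Du x k - pderiv k (φ n) x))
      atTop (𝓝 0)) (k : Fin 3) :
    Tendsto (fun n => eLpNorm (fun x => Du x k - pderiv k (φ n) x) 2 (volume.restrict Ω))
      atTop (𝓝 0) :=
  tendsto_nhds_bot_mono' h fun n =>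
    (Finset.single_le_sum (f := fun k => eLpNorm (fun x => Du x k - pderiv k (φ n) x) 2
      (volume.restrict Ω)) (fun _ _ => zero_le) (Finset.mem_univ k)).trans le_add_self

lemma isH10With_of_tendsto (hu : MemL2 Ω u) (hDu : ∀ k, MemL2 Ω (fun x => Du x k))
    (hφ : ∀ n, IsTestFunction Ω (φ n))
    (hlim : Tendsto (fun n => eLpNorm (fun x => u x - φ n x) 2 (volume.restrict Ω)) atTop (𝓝 0))
    (hgrad : ∀ k, Tendsto (fun n => eLpNorm (fun x => Du x k - pderiv k (φ n) x) 2
      (volume.restrict Ω)) atTop (𝓝 0)) :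
    IsH10With Ω u Du := by
  have hloc : ∀ {f : E3 → ℝ}, MemL2 Ω f → LocallyIntegrableOn f Ω := fun hf =>
    locallyIntegrableOn_of_locallyIntegrable_restrict (hf.locallyIntegrable one_le_two)
  refine ⟨⟨hu, hDu, fun k => ⟨hloc hu, hloc (hDu k), fun ψ hψ => ?_⟩⟩, φ, hφ, ?_⟩
  · have h₁ := tendsto_integral_mul_of_tendsto_eLpNorm hu (fun n => (hφ n).isH1With.mem)
      (hψ.isH1With.mem_grad k) hlim
    have h₂ := tendsto_integral_mul_of_tendsto_eLpNorm (hDu k)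
      (fun n => (hφ n).isH1With.mem_grad k) hψ.isH1With.mem (hgrad k)
    simp only [((hφ _).isH1With.weak k).integral_eq ψ hψ] at h₁
    exact tendsto_nhds_unique h₁ h₂.neg
  · simpa [h1Norm] using hlim.add (tendsto_finsetSum Finset.univ fun k _ => hgrad k)

lemma IsH1With.integral_mul_eq_neg {f : E3 → ℝ} {Df : E3 → Fin 3 → ℝ} (hf : IsH1With Ω f Df)
    (hu : IsH10With Ω u Du) (k : Fin 3) :
    ∫ x in Ω, Du x k * f x = -∫ x in Ω, u x * Df x k := by
  obtain ⟨φ, hφ, hlim⟩ := hu.approx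
  have h₁ := tendsto_integral_mul_of_tendsto_eLpNorm (hu.isH1.mem_grad k)
    (fun n => (hφ n).isH1With.mem_grad k) hf.mem (tendsto_eLpNorm_grad_of_tendsto_h1Norm hlim k)
  have h₂ := tendsto_integral_mul_of_tendsto_eLpNorm hu.isH1.mem
    (fun n => (hφ n).isH1With.mem) (hf.mem_grad k) (tendsto_eLpNorm_of_tendsto_h1Norm hlim)
  have hparts : ∀ n, ∫ x in Ω, pderiv k (φ n) x * f x = -∫ x in Ω, φ n x * Df x k := fun n => by
    simpa only [mul_comm] using (hf.weak k).integral_eq _ (hφ n)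
  simp only [hparts] at h₁
  exact tendsto_nhds_unique h₁ h₂.neg

end Approximation

section Composition

variable {u : E3 → EuclideanSpace ℝ ι} {D : Fin 3 → E3 → EuclideanSpace ℝ ι}

lemma exists_isTestFunction_tendsto_ae
    (hu : ∀ p, IsH10With Ω (fun x => u x p) (fun x k => D k x p)) :
    ∃ φ : ℕ → E3 → EuclideanSpace ℝ ι, (∀ n p, IsTestFunction Ω (fun x => φ n x p)) ∧
      (∀ᵐ x ∂volume.restrict Ω, Tendsto (fun n => φ n x) atTop (𝓝 (u x))) ∧
      ∀ p, Tendsto (fun n => h1Norm Ω (fun x => u x p - φ n x p)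
        (fun x k => D k x p - pderiv k (fun y => φ n y p) x)) atTop (𝓝 0) := by
  choose ψ hψ hlim using fun p => (hu p).approx
  let φ : ℕ → E3 → EuclideanSpace ℝ ι := fun n x => WithLp.toLp 2 fun p => ψ p n x
  have hφ_mem : ∀ n, MemLp (φ n) 2 (volume.restrict Ω) := fun n =>
    memLp_piLp_iff.2 fun p => (hψ p n).isH1With.mem
  have hu_mem : MemLp u 2 (volume.restrict Ω) := memLp_piLp_iff.2 fun p => (hu p).isH1.mem
  have hL2 : Tendsto (fun n => eLpNorm (φ n - u) 2 (volume.restrict Ω)) atTop (𝓝 0) := by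
    simp only [eLpNorm_sub_comm _ u]
    exact tendsto_eLpNorm_zero_of_apply
      (fun n p => (memLp_piLp_iff.1 (hu_mem.sub (hφ_mem n)) p).1) one_le_two
      fun p => tendsto_eLpNorm_of_tendsto_h1Norm (hlim p)
  obtain ⟨ns, hns, hae⟩ := (tendstoInMeasure_of_tendsto_eLpNorm two_ne_zero
    (fun n => (hφ_mem n).1) hu_mem.1 hL2).exists_seq_tendsto_ae
  exact ⟨fun n => φ (ns n), fun n p => hψ p (ns n), hae, fun p => (hlim p).comp hns.tendsto_atTop⟩

lemma isTestFunction_comp {φ : E3 → EuclideanSpace ℝ ι}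
    (hφ : ∀ p, IsTestFunction Ω (fun x => φ x p)) {G : EuclideanSpace ℝ ι → ℝ}
    (hG : ContDiff ℝ ∞ G) (hG₀ : G 0 = 0) : IsTestFunction Ω (fun x => G (φ x)) := by
  have hsub : tsupport (fun x => G (φ x)) ⊆ ⋃ p, tsupport (fun x => φ x p) := by
    refine closure_minimal (fun x hx => ?_) (isClosed_iUnion_of_finite fun p => isClosed_tsupport _)
    contrapose! hx
    rw [mem_iUnion, not_exists] at hx
    have hzero : φ x = 0 := PiLp.ext fun p =>
      image_eq_zero_of_notMem_tsupport (f := fun x => φ x p) (hx p)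
    simp [hzero, hG₀]
  exact ⟨hG.comp (contDiff_euclidean.2 fun p => (hφ p).smooth),
    (isCompact_iUnion fun p => (hφ p).compact).of_isClosed_subset (isClosed_tsupport _) hsub,
    hsub.trans (iUnion_subset fun p => (hφ p).subset)⟩

lemma pderiv_comp {φ : E3 → EuclideanSpace ℝ ι} (hφ : Differentiable ℝ φ)
    {G : EuclideanSpace ℝ ι → ℝ} (hG : Differentiable ℝ G) (k : Fin 3) (x : E3) :
    pderiv k (fun y => G (φ y)) x
      = fderiv ℝ G (φ x) (WithLp.toLp 2 fun p => pderiv k (fun y => φ y p) x) := by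
  have happly : ∀ p, pderiv k (fun y => φ y p) x = fderiv ℝ φ x (EuclideanSpace.single k 1) p :=
    fun p => congrArg (fun L : E3 →L[ℝ] ℝ => L (EuclideanSpace.single k 1))
      (((EuclideanSpace.proj p : EuclideanSpace ℝ ι →L[ℝ] ℝ).hasFDerivAt (x := φ x)).comp x
        (hφ x).hasFDerivAt).fderiv
  simp only [happly, WithLp.toLp_ofLp]
  exact congrArg (fun L : E3 →L[ℝ] ℝ => L (EuclideanSpace.single k 1))
    ((hG _).hasFDerivAt.comp x (hφ x).hasFDerivAt).fderiv

lemma isH10With_comp (hu : ∀ p, IsH10With Ω (fun x => u x p) (fun x k => D k x p))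
    {G : EuclideanSpace ℝ ι → ℝ} {K : NNReal} (hG : ContDiff ℝ ∞ G) (hK : LipschitzWith K G)
    (hG₀ : G 0 = 0) :
    IsH10With Ω (fun x => G (u x)) (fun x k => fderiv ℝ G (u x) (D k x)) := by
  obtain ⟨φ, hφ, hae, hlim⟩ := exists_isTestFunction_tendsto_ae hu
  have hu_mem : MemLp u 2 (volume.restrict Ω) := memLp_piLp_iff.2 fun p => (hu p).isH1.mem
  have hD_mem : ∀ k, MemLp (D k) 2 (volume.restrict Ω) := fun k =>
    memLp_piLp_iff.2 fun p => (hu p).isH1.mem_grad k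
  have hφ_smooth : ∀ n, ContDiff ℝ ∞ (φ n) := fun n =>
    contDiff_euclidean.2 fun p => (hφ n p).smooth
  have hφ_meas : ∀ n, AEStronglyMeasurable (φ n) (volume.restrict Ω) := fun n =>
    (hφ_smooth n).continuous.aestronglyMeasurable
  have hgrad_mem : ∀ n k, MemLp (fun x =>
      (WithLp.toLp 2 fun p => pderiv k (fun y => φ n y p) x : EuclideanSpace ℝ ι)) 2
      (volume.restrict Ω) := fun n k => by
    rw [memLp_piLp_iff]
    exact fun p => (hφ n p).isH1With.mem_grad k
  have hdG : Continuous (fderiv ℝ G) := hG.continuous_fderiv (by simp)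
  have hdG_le : ∀ y, ‖fderiv ℝ G y‖ ≤ K := fun y => norm_fderiv_le_of_lipschitz ℝ hK
  refine isH10With_of_tendsto (φ := fun n x => G (φ n x)) (hK.comp_memLp hG₀ hu_mem)
    (fun k => (hD_mem k).of_le_mul ?_ (.of_forall fun x => (fderiv ℝ G (u x)).le_of_opNorm_le
      (hdG_le _) _)) (fun n => isTestFunction_comp (hφ n) hG hG₀) ?_ fun k => ?_
  · exact isBoundedBilinearMap_apply.continuous.comp_aestronglyMeasurable
      ((hdG.comp_aestronglyMeasurable hu_mem.1).prodMk (hD_mem k).1)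
  · have hL2 : Tendsto (fun n => eLpNorm (u - φ n) 2 (volume.restrict Ω)) atTop (𝓝 0) :=
      tendsto_eLpNorm_zero_of_apply (fun n p => (hu p).isH1.mem.1.sub (hφ n p).isH1With.mem.1)
        one_le_two fun p => tendsto_eLpNorm_of_tendsto_h1Norm (hlim p)
    exact tendsto_eLpNorm_zero_of_norm_le_mul hL2 fun n x => hK.norm_sub_le _ _
  · simp only [pderiv_comp ((hφ_smooth _).differentiable (by simp))
      (hG.differentiable (by simp))]
    refine tendsto_eLpNorm_clm_apply_sub one_le_two (by simp)
      (hdG.comp_aestronglyMeasurable hu_mem.1) (fun n => hdG.comp_aestronglyMeasurable (hφ_meas n))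
      (fun x => hdG_le _) (fun n x => hdG_le _) ?_ (hD_mem k) (fun n => (hgrad_mem n k).1) ?_
    · filter_upwards [hae] with x hx using (hdG.tendsto (u x)).comp hx
    · exact tendsto_eLpNorm_zero_of_apply
        (fun n p => ((hu p).isH1.mem_grad k).1.sub ((hφ n p).isH1With.mem_grad k).1) one_le_two
        fun p => tendsto_eLpNorm_grad_of_tendsto_h1Norm (hlim p) k

end Composition

end Sobolev

section SobolevEmbedding

variable {Ω : Set E3}

lemma norm_fderiv_le_sum_pderiv (φ : E3 → ℝ) (x : E3) :
    ‖fderiv ℝ φ x‖ ≤ ∑ k, ‖pderiv k φ x‖ := by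
  refine ContinuousLinearMap.opNorm_le_bound _ (Finset.sum_nonneg fun _ _ => norm_nonneg _)
    fun y => ?_
  calc ‖fderiv ℝ φ x y‖ = ‖∑ k, y k * pderiv k φ x‖ := by
        conv_lhs => rw [← (EuclideanSpace.basisFun (Fin 3) ℝ).sum_repr y, map_sum]
        simp [pderiv]
    _ ≤ ∑ k, ‖y k‖ * ‖pderiv k φ x‖ := by
        simpa only [norm_mul] using norm_sum_le Finset.univ fun k => y k * pderiv k φ x
    _ ≤ (∑ k, ‖pderiv k φ x‖) * ‖y‖ := by
        rw [Finset.sum_mul]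
        exact Finset.sum_le_sum fun k _ => by
          rw [mul_comm]
          exact mul_le_mul_of_nonneg_left (PiLp.norm_apply_le y k) (norm_nonneg _)

lemma IsTestFunction.eLpNorm_fderiv_le {φ : E3 → ℝ} (hφ : IsTestFunction Ω φ) :
    eLpNorm (fderiv ℝ φ) 2 volume ≤ ∑ k, eLpNorm (pderiv k φ) 2 (volume.restrict Ω) := by
  have hsupp : ∀ k, (Function.support fun x => ‖pderiv k φ x‖) ⊆ Ω := fun k x hx =>
    hφ.subset (support_fderiv_subset ℝ fun h => hx (by simp [pderiv, h]))
  calc eLpNorm (fderiv ℝ φ) 2 volume ≤ eLpNorm (fun x => ∑ k, ‖pderiv k φ x‖) 2 volume :=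
        eLpNorm_mono_real (norm_fderiv_le_sum_pderiv φ)
    _ ≤ ∑ k, eLpNorm (fun x => ‖pderiv k φ x‖) 2 volume := by
        rw [← Finset.sum_fn]
        exact eLpNorm_sum_le
          (fun k _ => (hφ.continuous_pderiv k).norm.aestronglyMeasurable) one_le_two
    _ = ∑ k, eLpNorm (pderiv k φ) 2 (volume.restrict Ω) := Finset.sum_congr rfl fun k _ => by
        rw [← eLpNorm_restrict_eq_of_support_subset (hsupp k), eLpNorm_norm]

lemma IsTestFunction.eLpNorm_six_le {φ : E3 → ℝ} (hφ : IsTestFunction Ω φ) :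
    eLpNorm φ 6 (volume.restrict Ω) ≤ SNormLESNormFDerivOfEqConst ℝ (volume : Measure E3) 2
      * ∑ k, eLpNorm (pderiv k φ) 2 (volume.restrict Ω) := by
  have hsobolev : eLpNorm φ (6 : NNReal) volume
      ≤ SNormLESNormFDerivOfEqConst ℝ (volume : Measure E3) 2 * eLpNorm (fderiv ℝ φ) 2 volume :=
    eLpNorm_le_eLpNorm_fderiv_of_eq (p := 2) (volume : Measure E3) (hφ.smooth.of_le (by simp))
      hφ.compact (by norm_num) (by simp) (by simp; norm_num)
  calc eLpNorm φ 6 (volume.restrict Ω) ≤ eLpNorm φ 6 volume :=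
        eLpNorm_mono_measure φ Measure.restrict_le_self
    _ ≤ _ * eLpNorm (fderiv ℝ φ) 2 volume := hsobolev
    _ ≤ _ := by gcongr; exact hφ.eLpNorm_fderiv_le

lemma exists_eLpNorm_six_le_h1Norm (Ω : Set E3) :
    ∃ C : NNReal, ∀ (u : E3 → ℝ) (Du : E3 → Fin 3 → ℝ), IsH10With Ω u Du →
      eLpNorm u 6 (volume.restrict Ω) ≤ C * h1Norm Ω u Du := by
  refine ⟨SNormLESNormFDerivOfEqConst ℝ (volume : Measure E3) 2, fun u Du hu => ?_⟩
  obtain ⟨φ, hφ, hae, hlim⟩ := exists_isTestFunction_tendsto_ae (ι := Unit)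
    (u := fun x => WithLp.toLp 2 fun _ => u x) (D := fun k x => WithLp.toLp 2 fun _ => Du x k)
    fun _ => hu
  have hae_apply : ∀ᵐ x ∂volume.restrict Ω, Tendsto (fun n => φ n x ()) atTop (𝓝 (u x)) := by
    filter_upwards [hae] with x hx
    exact ((PiLp.continuous_apply 2 (fun _ : Unit => ℝ) ()).tendsto _).comp hx
  have hgrad : ∀ n, ∑ k, eLpNorm (pderiv k fun x => φ n x ()) 2 (volume.restrict Ω)
      ≤ h1Norm Ω u Du
        + h1Norm Ω (fun x => u x - φ n x ()) (fun x k => Du x k - pderiv k (φ n · ()) x) := by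
    refine fun n => le_trans ?_ (add_le_add le_add_self le_add_self)
    rw [← Finset.sum_add_distrib]
    refine Finset.sum_le_sum fun k _ => ?_
    have hk := (hu.isH1.mem_grad k).1
    have hsplit : (pderiv k fun x => φ n x ())
        = (fun x => Du x k) - fun x => Du x k - pderiv k (φ n · ()) x := by
      ext x
      simp
    conv_lhs => rw [hsplit]
    exact eLpNorm_sub_le hk (hk.sub ((hφ n ()).isH1With.mem_grad k).1) one_le_two
  have hbound : Tendsto (fun n => (SNormLESNormFDerivOfEqConst ℝ (volume : Measure E3) 2 : ℝ≥0∞)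
      * (h1Norm Ω u Du
        + h1Norm Ω (fun x => u x - φ n x ()) (fun x k => Du x k - pderiv k (φ n · ()) x)))
      atTop (𝓝 (SNormLESNormFDerivOfEqConst ℝ (volume : Measure E3) 2 * h1Norm Ω u Du)) := by
    simpa using ENNReal.Tendsto.const_mul (tendsto_const_nhds.add (hlim ()))
      (.inr ENNReal.coe_ne_top)
  calc eLpNorm u 6 (volume.restrict Ω)
      ≤ liminf (fun n => eLpNorm (fun x => φ n x ()) 6 (volume.restrict Ω)) atTop :=
        Lp.eLpNorm_lim_le_liminf_eLpNorm
          (fun n => (hφ n ()).smooth.continuous.aestronglyMeasurable) u hae_apply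
    _ ≤ SNormLESNormFDerivOfEqConst ℝ (volume : Measure E3) 2 * h1Norm Ω u Du :=
        hbound.liminf_eq ▸ liminf_le_liminf (.of_forall fun n =>
          (hφ n ()).eLpNorm_six_le.trans (mul_le_mul_right (hgrad n) _))

lemma memLp_prod_of_eLpNorm_slice_le {X Y : Type*} [MeasurableSpace X] [MeasurableSpace Y]
    {E : Type*} [NormedAddCommGroup E] {μ : Measure X} [SFinite μ] {ν : Measure Y}
    [IsFiniteMeasure ν] {p : ℝ≥0∞} (hp₀ : p ≠ 0) (hp : p ≠ ⊤) {u : Y → X → E} {M : ℝ≥0∞}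
    (hM : M ≠ ⊤) (hm : AEStronglyMeasurable (fun z : X × Y => u z.2 z.1) (μ.prod ν))
    (hb : ∀ᵐ y ∂ν, eLpNorm (u y) p μ ≤ M) :
    MemLp (fun z : X × Y => u z.2 z.1) p (μ.prod ν) := by
  have hp_pos : 0 < p.toReal := ENNReal.toReal_pos hp₀ hp
  refine ⟨hm, ?_⟩
  rw [eLpNorm_lt_top_iff_lintegral_rpow_enorm_lt_top hp₀ hp]
  calc ∫⁻ z, ‖u z.2 z.1‖ₑ ^ p.toReal ∂μ.prod ν
      = ∫⁻ y, ∫⁻ x, ‖u y x‖ₑ ^ p.toReal ∂μ ∂ν := lintegral_prod_symm _ (hm.enorm.pow_const _)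
    _ ≤ ∫⁻ _, M ^ p.toReal ∂ν := by
        refine lintegral_mono_ae ?_
        filter_upwards [hb] with y hy
        rw [eLpNorm_eq_lintegral_rpow_enorm_toReal hp₀ hp, one_div,
          ENNReal.rpow_inv_le_iff hp_pos] at hy
        exact hy
    _ < ⊤ := by
        rw [lintegral_const]
        exact ENNReal.mul_lt_top (ENNReal.rpow_lt_top_of_nonneg hp_pos.le hM) (measure_lt_top _ _)

end SobolevEmbedding

section Dissipation

variable {ι : Type*} [Fintype ι] {Ω : Set E3} {c₀ : ℝ}

lemma inner_penaltyGrad_nonneg {E : Type*} [NormedAddCommGroup E] [InnerProductSpace ℝ E]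
    (hc₀ : 0 ≤ c₀) {y r : E} (h : c₀ ≤ ‖y‖ → 0 ≤ inner ℝ y r) :
    0 ≤ inner ℝ (penaltyGrad c₀ y) r := by
  rcases le_total c₀ ‖y‖ with hy | hy
  · obtain ⟨m, hm, hmy⟩ := exists_penaltyGrad_eq_smul c₀ y
    rw [hmy, real_inner_smul_left]
    exact mul_nonneg hm (h hy)
  · rw [penaltyGrad_of_norm_le hc₀ hy, inner_zero_left]

lemma integrable_inner_of_norm_le_one {X E : Type*} [MeasurableSpace X] {μ : Measure X}
    [NormedAddCommGroup E] [InnerProductSpace ℝ E] {f g : X → E} (hf : AEStronglyMeasurable f μ)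
    (hf_le : ∀ x, ‖f x‖ ≤ 1) (hg : Integrable g μ) : Integrable (fun x => inner ℝ (f x) (g x)) μ :=
  hg.norm.mono' (hf.inner hg.1) (.of_forall fun x => (norm_inner_le_norm _ _).trans
    (mul_le_of_le_one_left (norm_nonneg _) (hf_le x)))

lemma integrable_inner_of_memLp_two {X : Type*} [MeasurableSpace X] {μ : Measure X}
    {f g : X → EuclideanSpace ℝ ι} (hf : ∀ p, MemLp (fun x => f x p) 2 μ)
    (hg : ∀ p, MemLp (fun x => g x p) 2 μ) : Integrable (fun x => inner ℝ (f x) (g x)) μ :=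
  integrable_finsetSum _ fun p _ => (hg p).integrable_mul (hf p)

lemma integral_inner_eq_sum_integral_mul {X : Type*} [MeasurableSpace X] {μ : Measure X}
    {f g : X → EuclideanSpace ℝ ι} (hf : ∀ p, MemLp (fun x => f x p) 2 μ)
    (hg : ∀ p, MemLp (fun x => g x p) 2 μ) :
    ∫ x, inner ℝ (f x) (g x) ∂μ = ∑ p, ∫ x, g x p * f x p ∂μ :=
  integral_finsetSum _ fun p _ => (hg p).integrable_mul (hf p)

section Slice

variable {u : E3 → EuclideanSpace ℝ ι} {D : E3 → Fin 3 → EuclideanSpace ℝ ι}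

lemma IsL2Sigma.integral_fderiv_drift_eq_zero {w : E3 → E3} (hw : IsL2Sigma Ω w)
    (hu : ∀ p, IsH10With Ω (fun x => u x p) (fun x k => D x k p))
    {G : EuclideanSpace ℝ ι → ℝ} {K : NNReal} (hG : ContDiff ℝ ∞ G) (hK : LipschitzWith K G)
    (hG₀ : G 0 = 0) : ∫ x in Ω, fderiv ℝ G (u x) (∑ k, w x k • D x k) = 0 := by
  simpa only [map_sum, map_smul, smul_eq_mul] using
    hw.normal_trace _ _ (isH10With_comp (D := fun k x => D x k) hu hG hK hG₀).isH1

lemma integral_inner_laplacian_nonpos {D2 : E3 → Fin 3 → Fin 3 → EuclideanSpace ℝ ι}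
    (hu : ∀ p, IsH10With Ω (fun x => u x p) (fun x k => D x k p))
    (hD : ∀ p k, IsH1With Ω (fun x => D x k p) (fun x l => D2 x k l p))
    {W : EuclideanSpace ℝ ι → EuclideanSpace ℝ ι} {K : NNReal} (hW : ContDiff ℝ ∞ W)
    (hK : LipschitzWith K W) (hW₀ : W 0 = 0) (hmono : ∀ y z, 0 ≤ inner ℝ (fderiv ℝ W y z) z) :
    ∫ x in Ω, inner ℝ (W (u x)) (∑ k, D2 x k k) ≤ 0 := by
  have hfderiv : ∀ p y z, fderiv ℝ (fun y => W y p) y z = fderiv ℝ W y z p := fun p y z =>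
    congrArg (fun L : EuclideanSpace ℝ ι →L[ℝ] ℝ => L z)
      (((EuclideanSpace.proj p : EuclideanSpace ℝ ι →L[ℝ] ℝ).hasFDerivAt (x := W y)).comp y
        (hW.differentiable (by simp) y).hasFDerivAt).fderiv
  have hWu : ∀ p, IsH10With Ω (fun x => W (u x) p)
      (fun x k => fderiv ℝ W (u x) (D x k) p) := fun p => by
    simpa only [hfderiv] using isH10With_comp (D := fun k x => D x k) hu
      (contDiff_euclidean.1 hW p)
      (LipschitzWith.of_dist_le_mul fun y z =>
        (PiLp.norm_apply_le (W y - W z) p).trans (by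
          simpa only [dist_eq_norm] using hK.dist_le_mul y z))
      (by rw [hW₀, PiLp.zero_apply])
  have hparts : ∀ k p, ∫ x in Ω, D2 x k k p * W (u x) p
      = -∫ x in Ω, D x k p * fderiv ℝ W (u x) (D x k) p := fun k p => by
    have := (hD p k).integral_mul_eq_neg (hWu p) k
    simp only [mul_comm (D2 _ _ _ _), mul_comm (D _ _ _), this, neg_neg]
  have hinner : ∀ k, ∫ x in Ω, inner ℝ (W (u x)) (D2 x k k)
      = -∫ x in Ω, inner ℝ (fderiv ℝ W (u x) (D x k)) (D x k) := fun k => by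
    rw [integral_inner_eq_sum_integral_mul (fun p => (hWu p).isH1.mem)
        (fun p => (hD p k).mem_grad k),
      integral_inner_eq_sum_integral_mul (fun p => (hWu p).isH1.mem_grad k)
        (fun p => (hD p k).mem), ← Finset.sum_neg_distrib]
    exact Finset.sum_congr rfl fun p _ => hparts k p
  have hint : ∀ k, Integrable (fun x => inner ℝ (W (u x)) (D2 x k k)) (volume.restrict Ω) :=
    fun k => integrable_inner_of_memLp_two (fun p => (hWu p).isH1.mem)
      (fun p => (hD p k).mem_grad k)
  simp only [inner_sum]
  rw [integral_finsetSum _ fun k _ => hint k]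
  refine Finset.sum_nonpos fun k _ => ?_
  rw [hinner, neg_nonpos]
  exact integral_nonneg fun x => hmono _ _

lemma integral_inner_penaltyGrad_nonpos {w : E3 → E3} {r : E3 → EuclideanSpace ℝ ι}
    {D2 : E3 → Fin 3 → Fin 3 → EuclideanSpace ℝ ι} (hc₀ : 0 ≤ c₀) (hw : IsL2Sigma Ω w)
    (hu : ∀ p, IsH10With Ω (fun x => u x p) (fun x k => D x k p))
    (hD : ∀ p k, IsH1With Ω (fun x => D x k p) (fun x l => D2 x k l p))
    (hr : ∀ᵐ x ∂volume.restrict Ω, c₀ ≤ ‖u x‖ → 0 ≤ inner ℝ (u x) (r x))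
    (hint_diff : Integrable (fun x => ∑ k, D2 x k k) (volume.restrict Ω))
    (hint_r : Integrable r (volume.restrict Ω))
    (hint_drift : Integrable (fun x => ∑ k, w x k • D x k) (volume.restrict Ω)) :
    ∫ x in Ω, inner ℝ (penaltyGrad c₀ (u x)) (∑ k, D2 x k k - r x - ∑ k, w x k • D x k) ≤ 0 := by
  obtain ⟨C, hC⟩ := exists_norm_fderiv_penaltyGrad_le (E := EuclideanSpace ℝ ι) c₀
  have hW : ContDiff ℝ ∞ (penaltyGrad (E := EuclideanSpace ℝ ι) c₀) := contDiff_penaltyGrad c₀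
  have hdiff : ∫ x in Ω, inner ℝ (penaltyGrad c₀ (u x)) (∑ k, D2 x k k) ≤ 0 :=
    integral_inner_laplacian_nonpos hu hD hW
      (lipschitzWith_of_nnnorm_fderiv_le (C := C.toNNReal) (hW.differentiable (by simp))
        fun y => NNReal.le_toNNReal_of_coe_le (hC y))
      (penaltyGrad_of_norm_le hc₀ (by simpa using hc₀)) (inner_fderiv_penaltyGrad_nonneg c₀)
  have hreact : 0 ≤ ∫ x in Ω, inner ℝ (penaltyGrad c₀ (u x)) (r x) :=
    integral_nonneg_of_ae (hr.mono fun x hx => inner_penaltyGrad_nonneg hc₀ hx)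
  have htransport : ∫ x in Ω, inner ℝ (penaltyGrad c₀ (u x)) (∑ k, w x k • D x k) = 0 := by
    simpa only [(hasFDerivAt_penalty c₀ _).fderiv, innerSL_apply_apply] using
      hw.integral_fderiv_drift_eq_zero hu (contDiff_penalty c₀) (lipschitzWith_penalty c₀)
        ((penalty_eq_zero_iff hc₀).2 (by simpa using hc₀))
  have hint {g : E3 → EuclideanSpace ℝ ι} (hg : Integrable g (volume.restrict Ω)) :
      Integrable (fun x => inner ℝ (penaltyGrad c₀ (u x)) (g x)) (volume.restrict Ω) :=
    integrable_inner_of_norm_le_one (hW.continuous.comp_aestronglyMeasurable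
      (memLp_piLp_iff.2 fun p => (hu p).isH1.mem).1) (fun x => norm_penaltyGrad_le_one c₀ _) hg
  simp only [inner_sub_right]
  rw [integral_sub ?_ (hint hint_drift), integral_sub (hint hint_diff) (hint hint_r), htransport]
  · linarith
  · exact (hint hint_diff).sub (hint hint_r)

end Slice

end Dissipation

section DriftDiffusion

variable {ι : Type*} [Fintype ι]

/-- `u` is a weak solution on `(0, T₁)` of the system `∂ₜu + (w · ∇)u = Δu - R(u)` in `Ω` for maps
with values in the subspace `V`, where `w` is solenoidal and tangential to the boundary and `u`
vanishes on the boundary. The weak derivatives are `Du t x k = ∂ₖu` and `D2u t x k l = ∂ₗ∂ₖu`. The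
equation is tested with `V`-valued functions only, so that it determines `R(u)` modulo `Vᗮ`. -/
structure IsDriftDiffusion (Ω : Set E3) (V : Submodule ℝ (EuclideanSpace ℝ ι))
    (R : EuclideanSpace ℝ ι → EuclideanSpace ℝ ι) (T₁ : ℝ) (w : ℝ → E3 → E3)
    (u : ℝ → E3 → EuclideanSpace ℝ ι) (Du : ℝ → E3 → Fin 3 → EuclideanSpace ℝ ι)
    (D2u : ℝ → E3 → Fin 3 → Fin 3 → EuclideanSpace ℝ ι) : Prop where
  drift : ∀ t ∈ Ioo 0 T₁, IsL2Sigma Ω (w t)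
  drift_mem : ∀ T ∈ Ioo 0 T₁, ∀ k, MemL2L2 Ω T (fun t x => w t x k)
  values : ∀ t ∈ Ico 0 T₁, ∀ᵐ x ∂volume.restrict Ω, u t x ∈ V
  initial : ∀ p, MemL2 Ω (fun x => u 0 x p)
  bounded : ∀ T ∈ Ioo 0 T₁, ∀ p, ∃ C : ℝ, ∀ t ∈ Ioo 0 T,
    h1Norm Ω (fun x => u t x p) (fun x k => Du t x k p) ≤ ENNReal.ofReal C
  regularity : ∀ T ∈ Ioo 0 T₁, ∀ p, IsL2H2 Ω T (fun t x => u t x p) (fun t x k => Du t x k p)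
    (fun t x k l => D2u t x k l p)
  boundary : ∀ t ∈ Ioo 0 T₁, ∀ p, IsH10With Ω (fun x => u t x p) (fun x k => Du t x k p)
  equation : ∀ T ∈ Ioo 0 T₁, ∀ φ, IsTestFunction Ω φ → ∀ A ∈ V,
    ((∫ x in Ω, φ x * inner ℝ A (u T x)) - ∫ x in Ω, φ x * inner ℝ A (u 0 x))
      + (∫ t in (0 : ℝ)..T, ∫ x in Ω, φ x * inner ℝ A (∑ k, w t x k • Du t x k))
    = ∫ t in (0 : ℝ)..T, ∫ x in Ω, φ x * inner ℝ A (∑ k, D2u t x k k - R (u t x))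

lemma restrict_prod_Ioo (Ω : Set E3) (T : ℝ) : (volume.restrict (Ω ×ˢ Ioo 0 T) : Measure (E3 × ℝ))
    = (volume.restrict Ω).prod (volume.restrict (Ioo 0 T)) := by
  rw [Measure.prod_restrict, Measure.volume_eq_prod]

lemma MemL2L2.memLp_prod {Ω : Set E3} {T : ℝ} {f : ℝ → E3 → ℝ} (hf : MemL2L2 Ω T f) :
    MemLp (fun z : E3 × ℝ => f z.2 z.1) 2
      ((volume.restrict Ω).prod (volume.restrict (Ioo 0 T))) :=
  restrict_prod_Ioo Ω T ▸ hf

lemma starProjection_ae_eq_zero {E : Type*} [NormedAddCommGroup E] [InnerProductSpace ℝ E]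
    [CompleteSpace E] {V : Submodule ℝ E} [V.HasOrthogonalProjection] {Ω : Set E3}
    (hΩ : IsOpen Ω) {h : E3 → E} (hh : Integrable h (volume.restrict Ω))
    (horth : ∀ φ, IsTestFunction Ω φ → ∀ A ∈ V, ∫ x in Ω, φ x * inner ℝ A (h x) = 0) :
    ∀ᵐ x ∂volume.restrict Ω, V.starProjection (h x) = 0 := by
  have hint : IntegrableOn (fun x => V.starProjection (h x)) Ω :=
    V.starProjection.integrable_comp hh
  rw [ae_restrict_iff' hΩ.measurableSet]
  refine hΩ.ae_eq_zero_of_integral_contDiff_smul_eq_zero hint.locallyIntegrableOn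
    fun φ hφ hφc hφΩ => ?_
  have htest : IsTestFunction Ω φ := ⟨hφ, hφc, hφΩ⟩
  rw [← setIntegral_eq_integral_of_forall_compl_eq_zero fun x hx => by
    rw [htest.eq_zero_of_notMem hx, zero_smul]]
  obtain ⟨C, hC⟩ := hφ.continuous.bounded_above_of_compact_support hφc
  have hsmul : Integrable (fun x => φ x • V.starProjection (h x)) (volume.restrict Ω) :=
    hint.integrable.bdd_smul C hφ.continuous.aestronglyMeasurable (.of_forall hC)
  refine ext_inner_left ℝ fun A => ?_
  rw [← integral_inner hsmul, inner_zero_right]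
  simpa only [real_inner_smul_right, V.inner_starProjection_left_eq_right] using
    horth φ htest _ (V.starProjection_apply_mem A)

namespace IsDriftDiffusion

variable {Ω : Set E3} {V : Submodule ℝ (EuclideanSpace ℝ ι)}
  {R : EuclideanSpace ℝ ι → EuclideanSpace ℝ ι} {T₁ T : ℝ} {w : ℝ → E3 → E3}
  {u : ℝ → E3 → EuclideanSpace ℝ ι} {Du : ℝ → E3 → Fin 3 → EuclideanSpace ℝ ι}
  {D2u : ℝ → E3 → Fin 3 → Fin 3 → EuclideanSpace ℝ ι}

section Integrability

lemma memLp_six (h : IsDriftDiffusion Ω V R T₁ w u Du D2u) (hT : T ∈ Ioo 0 T₁) :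
    MemLp (fun z : E3 × ℝ => u z.2 z.1) 6
      ((volume.restrict Ω).prod (volume.restrict (Ioo 0 T))) := by
  obtain ⟨S, hS⟩ := exists_eLpNorm_six_le_h1Norm Ω
  refine memLp_piLp_iff.2 fun p => ?_
  obtain ⟨C, hC⟩ := h.bounded T hT p
  refine memLp_prod_of_eLpNorm_slice_le (u := fun t x => u t x p) (by simp) (by simp)
    (M := S * ENNReal.ofReal C) (by finiteness)
    (h.regularity T hT p).mem.memLp_prod.1 ?_
  filter_upwards [ae_restrict_mem measurableSet_Ioo] with t ht
  exact (hS _ _ (h.boundary t ⟨ht.1, ht.2.trans hT.2⟩ p)).trans (mul_le_mul_right (hC t ht) _)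

lemma integrable_drift (h : IsDriftDiffusion Ω V R T₁ w u Du D2u) (hT : T ∈ Ioo 0 T₁) :
    Integrable (fun z : E3 × ℝ => ∑ k, w z.2 z.1 k • Du z.2 z.1 k)
      ((volume.restrict Ω).prod (volume.restrict (Ioo 0 T))) :=
  integrable_finsetSum _ fun k _ => integrable_piLp_iff.2 fun p =>
    (h.drift_mem T hT k).memLp_prod.integrable_mul ((h.regularity T hT p).mem_grad k).memLp_prod

variable [IsFiniteMeasure (volume.restrict Ω)]

lemma integrable_reaction (h : IsDriftDiffusion Ω V R T₁ w u Du D2u) (hT : T ∈ Ioo 0 T₁)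
    (hR : Continuous R) {K : ℝ} (hK : ∀ y, ‖R y‖ ≤ K * (1 + ‖y‖ ^ 6)) :
    Integrable (fun z : E3 × ℝ => R (u z.2 z.1))
      ((volume.restrict Ω).prod (volume.restrict (Ioo 0 T))) :=
  (((integrable_const 1).add ((h.memLp_six hT).integrable_norm_pow (p := 6) (by simp))).const_mul
    K).mono' (hR.comp_aestronglyMeasurable (h.memLp_six hT).1) (.of_forall fun z => hK _)

lemma integrable_diffusion (h : IsDriftDiffusion Ω V R T₁ w u Du D2u) (hT : T ∈ Ioo 0 T₁) :
    Integrable (fun z : E3 × ℝ => ∑ k, D2u z.2 z.1 k k)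
      ((volume.restrict Ω).prod (volume.restrict (Ioo 0 T))) :=
  integrable_finsetSum _ fun k _ => integrable_piLp_iff.2 fun p =>
    ((h.regularity T hT p).mem_hess k k).memLp_prod.integrable one_le_two

end Integrability

end IsDriftDiffusion

end DriftDiffusion

section MaximumPrinciple

variable {ι : Type*} [Fintype ι]

/-- The time derivative `Δu - R(u) - (w · ∇)u` prescribed by a drift-diffusion system, up to its
component normal to the target space `V`. -/
def driftDiffusionRate (R : EuclideanSpace ℝ ι → EuclideanSpace ℝ ι) (w : ℝ → E3 → E3)
    (u : ℝ → E3 → EuclideanSpace ℝ ι) (Du : ℝ → E3 → Fin 3 → EuclideanSpace ℝ ι)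
    (D2u : ℝ → E3 → Fin 3 → Fin 3 → EuclideanSpace ℝ ι) (z : E3 × ℝ) : EuclideanSpace ℝ ι :=
  ∑ k, D2u z.2 z.1 k k - R (u z.2 z.1) - ∑ k, w z.2 z.1 k • Du z.2 z.1 k

section Fubini

variable {X E : Type*} [MeasurableSpace X] [TopologicalSpace X] [OpensMeasurableSpace X]
  {μ : Measure X} [NormedAddCommGroup E] [InnerProductSpace ℝ E] {T : ℝ} {φ : X → ℝ}
  {F : X × ℝ → E}

lemma integrable_mul_inner {Y : Type*} [MeasurableSpace Y] {ν : Measure Y} [SFinite ν]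
    {F : X × Y → E} (hφ : Continuous φ) (hφc : HasCompactSupport φ)
    (hF : Integrable F (μ.prod ν)) (A : E) :
    Integrable (fun z : X × Y => φ z.1 * inner ℝ A (F z)) (μ.prod ν) := by
  obtain ⟨C, hC⟩ := hφ.bounded_above_of_compact_support hφc
  exact (hF.const_inner A).bdd_mul (c := C) hφ.aestronglyMeasurable.comp_fst
    (.of_forall fun z => hC z.1)

variable [SFinite μ]

lemma intervalIntegral_integral_mul_inner (hT : 0 ≤ T) (hφ : Continuous φ)
    (hφc : HasCompactSupport φ) (hF : Integrable F (μ.prod (volume.restrict (Ioo 0 T)))) (A : E) :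
    ∫ t in (0 : ℝ)..T, ∫ x, φ x * inner ℝ A (F (x, t)) ∂μ
      = ∫ z, φ z.1 * inner ℝ A (F z) ∂μ.prod (volume.restrict (Ioo 0 T)) := by
  rw [integral_prod_symm _ (integrable_mul_inner hφ hφc hF A), intervalIntegral.integral_of_le hT,
    integral_Ioc_eq_integral_Ioo]

variable [CompleteSpace E]

lemma integral_prod_mul_inner (hT : 0 ≤ T) (hφ : Continuous φ)
    (hφc : HasCompactSupport φ) (hF : Integrable F (μ.prod (volume.restrict (Ioo 0 T)))) (A : E) :
    ∫ z, φ z.1 * inner ℝ A (F z) ∂μ.prod (volume.restrict (Ioo 0 T))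
      = ∫ x, φ x * inner ℝ A (∫ t in (0 : ℝ)..T, F (x, t)) ∂μ := by
  rw [integral_prod _ (integrable_mul_inner hφ hφc hF A)]
  refine integral_congr_ae ?_
  filter_upwards [hF.prod_right_ae] with x hx
  rw [integral_const_mul, integral_inner hx, intervalIntegral.integral_of_le hT,
    integral_Ioc_eq_integral_Ioo]

end Fubini

namespace IsDriftDiffusion

variable {Ω : Set E3} {V : Submodule ℝ (EuclideanSpace ℝ ι)}
  {R : EuclideanSpace ℝ ι → EuclideanSpace ℝ ι} {T₁ T : ℝ} {w : ℝ → E3 → E3}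
  {u : ℝ → E3 → EuclideanSpace ℝ ι} {Du : ℝ → E3 → Fin 3 → EuclideanSpace ℝ ι}
  {D2u : ℝ → E3 → Fin 3 → Fin 3 → EuclideanSpace ℝ ι}

lemma memLp_two (h : IsDriftDiffusion Ω V R T₁ w u Du D2u) {t : ℝ} (ht : t ∈ Ico 0 T₁) :
    MemLp (u t) 2 (volume.restrict Ω) := by
  rcases ht.1.eq_or_lt with rfl | ht₀
  · exact memLp_piLp_iff.2 h.initial
  · exact memLp_piLp_iff.2 fun p => (h.boundary t ⟨ht₀, ht.2⟩ p).isH1.mem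

variable [IsFiniteMeasure (volume.restrict Ω)]

lemma integrable_rate (h : IsDriftDiffusion Ω V R T₁ w u Du D2u) (hT : T ∈ Ioo 0 T₁)
    (hR : Continuous R) {K : ℝ} (hK : ∀ y, ‖R y‖ ≤ K * (1 + ‖y‖ ^ 6)) :
    Integrable (driftDiffusionRate R w u Du D2u)
      ((volume.restrict Ω).prod (volume.restrict (Ioo 0 T))) :=
  ((h.integrable_diffusion hT).sub (h.integrable_reaction hT hR hK)).sub (h.integrable_drift hT)

lemma integral_mul_inner_sub (h : IsDriftDiffusion Ω V R T₁ w u Du D2u) (hT : T ∈ Ioo 0 T₁)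
    (hR : Continuous R) {K : ℝ} (hK : ∀ y, ‖R y‖ ≤ K * (1 + ‖y‖ ^ 6)) {φ : E3 → ℝ}
    (hφ : IsTestFunction Ω φ) {A : EuclideanSpace ℝ ι} (hA : A ∈ V) :
    (∫ x in Ω, φ x * inner ℝ A (u T x)) - ∫ x in Ω, φ x * inner ℝ A (u 0 x)
      = ∫ x in Ω, φ x * inner ℝ A (∫ t in (0 : ℝ)..T, driftDiffusionRate R w u Du D2u (x, t)) := by
  have hcont := hφ.smooth.continuous
  have hsource : Integrable (fun z : E3 × ℝ => ∑ k, D2u z.2 z.1 k k - R (u z.2 z.1))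
      ((volume.restrict Ω).prod (volume.restrict (Ioo 0 T))) :=
    (h.integrable_diffusion hT).sub (h.integrable_reaction hT hR hK)
  have hdrift := h.integrable_drift hT
  rw [← integral_prod_mul_inner hT.1.le hcont hφ.compact (h.integrable_rate hT hR hK)]
  simp only [driftDiffusionRate, inner_sub_right _ (_ - _), mul_sub (φ _) (inner ℝ A (_ - _))]
  rw [integral_sub (integrable_mul_inner hcont hφ.compact hsource A)
      (integrable_mul_inner hcont hφ.compact hdrift A),
    ← intervalIntegral_integral_mul_inner hT.1.le hcont hφ.compact hsource,
    ← intervalIntegral_integral_mul_inner hT.1.le hcont hφ.compact hdrift, eq_sub_iff_add_eq]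
  exact h.equation T hT φ hφ A hA

lemma ae_eq_add_integral (h : IsDriftDiffusion Ω V R T₁ w u Du D2u) (hΩ : IsOpen Ω)
    (hT : T ∈ Ioo 0 T₁) (hR : Continuous R) {K : ℝ} (hK : ∀ y, ‖R y‖ ≤ K * (1 + ‖y‖ ^ 6)) :
    ∀ᵐ x ∂volume.restrict Ω, u T x
      = u 0 x + ∫ t in (0 : ℝ)..T, V.starProjection (driftDiffusionRate R w u Du D2u (x, t)) := by
  have hT₁ : (0 : ℝ) ∈ Ico 0 T₁ := ⟨le_rfl, hT.1.trans hT.2⟩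
  have hT' : T ∈ Ico 0 T₁ := Ioo_subset_Ico_self hT
  have hrate := h.integrable_rate hT hR hK
  have hu₀ := (h.memLp_two hT₁).integrable one_le_two
  have huT := (h.memLp_two hT').integrable one_le_two
  have hI : Integrable (fun x => ∫ t in (0 : ℝ)..T, driftDiffusionRate R w u Du D2u (x, t))
      (volume.restrict Ω) := by
    simpa only [intervalIntegral.integral_of_le hT.1.le, integral_Ioc_eq_integral_Ioo] using
      hrate.integral_prod_left
  have hproj := starProjection_ae_eq_zero (V := V) hΩ ((huT.sub hu₀).sub hI) fun φ hφ A hA => by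
    obtain ⟨C, hC⟩ := hφ.smooth.continuous.bounded_above_of_compact_support hφ.compact
    have hint {f : E3 → EuclideanSpace ℝ ι} (hf : Integrable f (volume.restrict Ω)) :
        Integrable (fun x => φ x * inner ℝ A (f x)) (volume.restrict Ω) :=
      (hf.const_inner A).bdd_mul (c := C) hφ.smooth.continuous.aestronglyMeasurable
        (.of_forall hC)
    simp only [Pi.sub_apply, inner_sub_right, mul_sub]
    rw [integral_sub ?_ (hint hI), integral_sub (hint huT) (hint hu₀),
      h.integral_mul_inner_sub hT hR hK hφ hA, sub_self]
    exact (hint huT).sub (hint hu₀)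
  filter_upwards [hproj, h.values 0 hT₁, h.values T hT', hrate.prod_right_ae] with x hx hx₀ hxT hxr
  have hxr' : IntervalIntegrable (fun t => driftDiffusionRate R w u Du D2u (x, t)) volume 0 T :=
    (intervalIntegrable_iff_integrableOn_Ioo_of_le hT.1.le).2 hxr
  rw [V.starProjection.intervalIntegral_comp_comm hxr', ← sub_eq_iff_eq_add', ← sub_eq_zero]
  simpa only [Pi.sub_apply, map_sub, Submodule.starProjection_eq_self_iff.2 hx₀,
    Submodule.starProjection_eq_self_iff.2 hxT] using hx

variable {c₀ K : ℝ}

lemma integral_fderiv_penalty_nonpos (h : IsDriftDiffusion Ω V R T₁ w u Du D2u)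
    (hT : T ∈ Ioo 0 T₁) (hR : Continuous R) (hK : ∀ y, ‖R y‖ ≤ K * (1 + ‖y‖ ^ 6)) (hc₀ : 0 ≤ c₀)
    (hinward : ∀ y ∈ V, c₀ ≤ ‖y‖ → 0 ≤ inner ℝ y (R y)) :
    ∀ᵐ t ∂volume.restrict (Ioo 0 T), ∫ x in Ω, fderiv ℝ (penalty c₀) (u t x)
      (V.starProjection (driftDiffusionRate R w u Du D2u (x, t))) ≤ 0 := by
  filter_upwards [ae_restrict_mem measurableSet_Ioo,
    ae_all_iff.2 fun p => (h.regularity T hT p).slice, (h.integrable_diffusion hT).prod_left_ae,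
    (h.integrable_reaction hT hR hK).prod_left_ae, (h.integrable_drift hT).prod_left_ae]
    with t ht hslice hdiff hreact hdrift
  have ht₁ : t ∈ Ioo 0 T₁ := ⟨ht.1, ht.2.trans hT.2⟩
  have hvalues := h.values t (Ioo_subset_Ico_self ht₁)
  have hproj : ∀ᵐ x ∂volume.restrict Ω, fderiv ℝ (penalty c₀) (u t x)
      (V.starProjection (driftDiffusionRate R w u Du D2u (x, t)))
      = inner ℝ (penaltyGrad c₀ (u t x)) (driftDiffusionRate R w u Du D2u (x, t)) := by
    filter_upwards [hvalues] with x hx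
    have hmem : penaltyGrad c₀ (u t x) ∈ V := by
      obtain ⟨m, -, hm⟩ := exists_penaltyGrad_eq_smul c₀ (u t x)
      exact hm ▸ V.smul_mem m hx
    rw [(hasFDerivAt_penalty c₀ _).fderiv, innerSL_apply_apply,
      ← V.inner_starProjection_left_eq_right, Submodule.starProjection_eq_self_iff.2 hmem]
  rw [integral_congr_ae hproj]
  exact integral_inner_penaltyGrad_nonpos hc₀ (h.drift t ht₁) (h.boundary t ht₁)
    (fun p k => (hslice p).2 k) (hvalues.mono fun x hx => hinward _ hx) hdiff hreact hdrift

lemma ae_norm_le (h : IsDriftDiffusion Ω V R T₁ w u Du D2u) (hΩ : IsOpen Ω) (hT : T ∈ Ioo 0 T₁)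
    (hR : Continuous R) (hK : ∀ y, ‖R y‖ ≤ K * (1 + ‖y‖ ^ 6)) (hc₀ : 0 ≤ c₀)
    (hinward : ∀ y ∈ V, c₀ ≤ ‖y‖ → 0 ≤ inner ℝ y (R y))
    (hinit : ∀ᵐ x ∂volume.restrict Ω, ‖u 0 x‖ ≤ c₀) :
    ∀ᵐ x ∂volume.restrict Ω, ‖u T x‖ ≤ c₀ := by
  have hpenalty := ae_eq_zero_of_integral_fderiv_nonpos hT.1 (h.memLp_six hT).1
    (h.memLp_two ⟨le_rfl, hT.1.trans hT.2⟩).1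
    (V.starProjection.integrable_comp (h.integrable_rate hT hR hK))
    (fun t ht => h.ae_eq_add_integral hΩ ⟨ht.1, ht.2.trans_lt hT.2⟩ hR hK)
    (lipschitzWith_penalty c₀) ((contDiff_penalty c₀).of_le (by simp)) (penalty_nonneg c₀)
    (hinit.mono fun x hx => (penalty_eq_zero_iff hc₀).2 hx)
    (h.integral_fderiv_penalty_nonpos hT hR hK hc₀ hinward)
  exact hpenalty.mono fun x hx => (penalty_eq_zero_iff hc₀).1 hx

lemma ae_norm_le_prod (h : IsDriftDiffusion Ω V R T₁ w u Du D2u) (hΩ : IsOpen Ω)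
    (hT : T ∈ Ioo 0 T₁) (hR : Continuous R) (hK : ∀ y, ‖R y‖ ≤ K * (1 + ‖y‖ ^ 6)) (hc₀ : 0 ≤ c₀)
    (hinward : ∀ y ∈ V, c₀ ≤ ‖y‖ → 0 ≤ inner ℝ y (R y))
    (hinit : ∀ᵐ x ∂volume.restrict Ω, ‖u 0 x‖ ≤ c₀) :
    ∀ᵐ z ∂volume.restrict (Ω ×ˢ Ioo 0 T), ‖u z.2 z.1‖ ≤ c₀ := by
  rw [restrict_prod_Ioo]
  refine ae_prod_of_ae_ae ((h.memLp_six hT).1.norm.nullMeasurableSet_le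
    aestronglyMeasurable_const) ?_
  filter_upwards [ae_restrict_mem measurableSet_Ioo] with t ht
  exact h.ae_norm_le hΩ ⟨ht.1, ht.2.trans hT.2⟩ hR hK hc₀ hinward hinit

end IsDriftDiffusion

lemma ae_restrict_prod_Ioo_of_forall_lt {Ω : Set E3} {T₁ : ℝ} {P : E3 × ℝ → Prop}
    (h : ∀ T ∈ Ioo 0 T₁, ∀ᵐ z ∂volume.restrict (Ω ×ˢ Ioo 0 T), P z) :
    ∀ᵐ z ∂volume.restrict (Ω ×ˢ Ioo 0 T₁), P z := by
  rcases le_or_gt T₁ 0 with hT₁ | hT₁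
  · simp [Ioo_eq_empty hT₁.not_gt]
  obtain ⟨τ, -, hτ, hlim⟩ := exists_seq_strictMono_tendsto' hT₁
  refine ae_restrict_of_ae_restrict_of_subset (t := ⋃ n, Ω ×ˢ Ioo 0 (τ n)) (fun z hz => ?_)
    ((ae_restrict_iUnion_iff _ _).2 fun n => h _ (hτ n))
  obtain ⟨n, hn⟩ := (hlim.eventually_const_lt hz.2.2).exists
  exact mem_iUnion.2 ⟨n, hz.1, hz.2.1, hn⟩

theorem IsDriftDiffusion.eLpNorm_le {Ω : Set E3} [IsFiniteMeasure (volume.restrict Ω)]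
    {V : Submodule ℝ (EuclideanSpace ℝ ι)} {R : EuclideanSpace ℝ ι → EuclideanSpace ℝ ι}
    {T₁ c₀ K : ℝ} {w : ℝ → E3 → E3} {u : ℝ → E3 → EuclideanSpace ℝ ι}
    {Du : ℝ → E3 → Fin 3 → EuclideanSpace ℝ ι} {D2u : ℝ → E3 → Fin 3 → Fin 3 → EuclideanSpace ℝ ι}
    (h : IsDriftDiffusion Ω V R T₁ w u Du D2u) (hΩ : IsOpen Ω) (hR : Continuous R)
    (hK : ∀ y, ‖R y‖ ≤ K * (1 + ‖y‖ ^ 6)) (hc₀ : 0 ≤ c₀)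
    (hinward : ∀ y ∈ V, c₀ ≤ ‖y‖ → 0 ≤ inner ℝ y (R y))
    (hinit : eLpNorm (u 0) ∞ (volume.restrict Ω) ≤ ENNReal.ofReal c₀) :
    eLpNorm (fun z : E3 × ℝ => u z.2 z.1) ∞ (volume.restrict (Ω ×ˢ Ioo 0 T₁))
      ≤ ENNReal.ofReal c₀ := by
  have hinit' : ∀ᵐ x ∂volume.restrict Ω, ‖u 0 x‖ ≤ c₀ := by
    filter_upwards [ae_le_eLpNormEssSup (f := u 0)] with x hx
    rw [← ofReal_norm] at hx
    exact (ENNReal.ofReal_le_ofReal_iff hc₀).1 (hx.trans (eLpNorm_exponent_top.symm.trans_le hinit))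
  rw [eLpNorm_exponent_top]
  exact eLpNormEssSup_le_of_ae_bound <| ae_restrict_prod_Ioo_of_forall_lt fun T hT =>
    h.ae_norm_le_prod hΩ hT hR hK hc₀ hinward hinit'

end MaximumPrinciple

section QTensors

/-- A `3 × 3` matrix as a vector of `ℝ⁹`. It turns `A : B` into the Euclidean inner product. -/
def vec : Mat3 ≃ₗ[ℝ] EuclideanSpace ℝ (Fin 3 × Fin 3) :=
  (Matrix.ofLinearEquiv ℝ).symm ≪≫ₗ (LinearEquiv.curry ℝ ℝ (Fin 3) (Fin 3)).symm ≪≫ₗ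
    (WithLp.linearEquiv 2 ℝ (Fin 3 × Fin 3 → ℝ)).symm

@[simp] lemma vec_apply (A : Mat3) (p : Fin 3 × Fin 3) : vec A p = A p.1 p.2 := rfl

lemma inner_vec (A B : Mat3) : inner ℝ (vec A) (vec B) = dot A B := by
  simp [PiLp.inner_apply, dot, Fintype.sum_prod_type, mul_comm]

lemma norm_vec_sq (A : Mat3) : ‖vec A‖ ^ 2 = dot A A := by
  rw [← inner_vec, real_inner_self_eq_norm_sq]

lemma norm_vec (A : Mat3) : ‖vec A‖ = frobNorm A := by
  rw [frobNorm, ← norm_vec_sq, Real.sqrt_sq (norm_nonneg _)]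

lemma dot_one (A : Mat3) : dot A 1 = A.trace := by
  simp [dot, Matrix.trace, Matrix.one_apply]

lemma norm_vec_mul_self_le (A : Mat3) : ‖vec (A * A)‖ ≤ ‖vec A‖ ^ 2 := by
  refine le_of_sq_le_sq ?_ (by positivity)
  rw [norm_vec_sq, norm_vec_sq, pow_two (dot A A)]
  calc dot (A * A) (A * A) ≤ ∑ i, ∑ j, (∑ k, A i k ^ 2) * ∑ k, A k j ^ 2 := by
        refine Finset.sum_le_sum fun i _ => Finset.sum_le_sum fun j _ => ?_
        rw [← pow_two, Matrix.mul_apply]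
        exact Finset.sum_mul_sq_le_sq_mul_sq _ _ _
    _ = dot A A * dot A A := by
        simp only [dot, ← pow_two, ← Finset.mul_sum, ← Finset.sum_mul]
        rw [Finset.sum_comm (f := fun j k => A k j ^ 2), pow_two (∑ i, _)]

lemma abs_dot_mul_self_le (A : Mat3) : |dot A (A * A)| ≤ ‖vec A‖ ^ 3 := by
  rw [← inner_vec]
  calc |inner ℝ (vec A) (vec (A * A))| ≤ ‖vec A‖ * ‖vec (A * A)‖ := abs_real_inner_le_norm _ _
    _ ≤ ‖vec A‖ * ‖vec A‖ ^ 2 := by gcongr; exact norm_vec_mul_self_le A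
    _ = ‖vec A‖ ^ 3 := by ring

lemma vec_bulkGrad (a b c : ℝ) (A : Mat3) :
    vec (bulkGrad a b c A) = a • vec A - b • vec (A * A) + (c * ‖vec A‖ ^ 2) • vec A
      + (b / 3 * ‖vec A‖ ^ 2) • vec 1 := by
  simp only [bulkGrad, map_add, map_sub, map_smul, norm_vec_sq]

lemma dot_bulkGrad {A : Mat3} (hA : A.trace = 0) (a b c : ℝ) :
    dot A (bulkGrad a b c A) = a * ‖vec A‖ ^ 2 - b * dot A (A * A) + c * ‖vec A‖ ^ 4 := by
  rw [← inner_vec, vec_bulkGrad]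
  simp only [inner_add_right, inner_sub_right, real_inner_smul_right, inner_vec, dot_one, hA,
    ← norm_vec_sq]
  ring

lemma dot_bulkGrad_nonneg {a b c c₀ : ℝ} (hc : 0 < c) (hc₀ : 0 ≤ c₀)
    (hμ : b ^ 2 / c ^ 2 - 2 * a / c ≤ c₀ ^ 2) {A : Mat3} (hA : A.trace = 0) (h : c₀ ≤ ‖vec A‖) :
    0 ≤ dot A (bulkGrad a b c A) := by
  rw [dot_bulkGrad hA]
  have hcubic : b * dot A (A * A) ≤ |b| * ‖vec A‖ ^ 3 := by
    refine (le_abs_self _).trans ?_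
    rw [abs_mul]
    gcongr
    exact abs_dot_mul_self_le A
  set s := ‖vec A‖
  have hs : b ^ 2 - 2 * a * c ≤ (c * s) ^ 2 :=
    calc b ^ 2 - 2 * a * c = (b ^ 2 / c ^ 2 - 2 * a / c) * c ^ 2 := by field_simp
      _ ≤ s ^ 2 * c ^ 2 := by gcongr; exact hμ.trans (by gcongr)
      _ = (c * s) ^ 2 := by ring
  have hquad : 0 ≤ a - |b| * s + c * s ^ 2 := by
    refine nonneg_of_mul_nonneg_right (a := 2 * c) ?_ (by positivity)
    nlinarith [sq_nonneg (c * s - |b|), sq_abs b]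
  calc 0 ≤ s ^ 2 * (a - |b| * s + c * s ^ 2) := by positivity
    _ = a * s ^ 2 - |b| * s ^ 3 + c * s ^ 4 := by ring
    _ ≤ a * s ^ 2 - b * dot A (A * A) + c * s ^ 4 := by gcongr

lemma norm_vec_bulkGrad_le (a b c : ℝ) (A : Mat3) :
    ‖vec (bulkGrad a b c A)‖
      ≤ (|a| + |b| + |c| + |b / 3| * ‖vec (1 : Mat3)‖) * (1 + ‖vec A‖ ^ 6) := by
  have hmul := norm_vec_mul_self_le A
  rw [vec_bulkGrad]
  set s := ‖vec A‖ with hs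
  have hs0 : 0 ≤ s := norm_nonneg _
  have hpow : ∀ k ≤ 6, s ^ k ≤ 1 + s ^ 6 := fun k hk => by
    rcases le_total s 1 with h1 | h1
    · exact (pow_le_one₀ hs0 h1).trans (by linarith [pow_nonneg hs0 6])
    · linarith [pow_le_pow_right₀ h1 hk]
  calc _ ≤ |a| * s + |b| * ‖vec (A * A)‖ + |c| * s ^ 2 * s
        + |b / 3| * s ^ 2 * ‖vec (1 : Mat3)‖ := by
        refine norm_add_le_of_le (norm_add_le_of_le (norm_sub_le_of_le ?_ ?_) ?_) ?_ <;>
          simp [norm_smul, hs, abs_div]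
    _ ≤ |a| * s ^ 1 + |b| * s ^ 2 + |c| * s ^ 3 + |b / 3| * s ^ 2 * ‖vec (1 : Mat3)‖ := by
        rw [pow_one, mul_assoc |c|, ← pow_succ]
        gcongr
    _ ≤ |a| * (1 + s ^ 6) + |b| * (1 + s ^ 6) + |c| * (1 + s ^ 6)
        + |b / 3| * (1 + s ^ 6) * ‖vec (1 : Mat3)‖ := by
        gcongr <;> exact hpow _ (by norm_num)
    _ = _ := by ring

/-- The space of Q-tensors as a subspace of `ℝ⁹`. -/
def qTensorVec : Submodule ℝ (EuclideanSpace ℝ (Fin 3 × Fin 3)) where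
  carrier := {y | vec.symm y ∈ QTensor}
  zero_mem' := by simp [QTensor]
  add_mem' hx hy := ⟨by rw [map_add, Matrix.transpose_add, hx.1, hy.1],
    by rw [map_add, Matrix.trace_add, hx.2, hy.2, add_zero]⟩
  smul_mem' r _ hx := ⟨by rw [map_smul, Matrix.transpose_smul, hx.1],
    by rw [map_smul, Matrix.trace_smul, hx.2, smul_zero]⟩

lemma vec_mem_qTensorVec {A : Mat3} : vec A ∈ qTensorVec ↔ A ∈ QTensor := by
  rw [← vec.symm_apply_apply A]; rfl

end QTensors

section WeakSolutions

variable {Ω : Set E3} {a b c ε T₁ : ℝ} {v₀ : E3 → E3} {Q₀ : E3 → Mat3} {v : ℝ → E3 → E3}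
  {Dv : ℝ → E3 → Mat3} {Q : ℝ → E3 → Mat3} {DQ : ℝ → E3 → Fin 3 → Fin 3 → Fin 3 → ℝ}
  {D2Q : ℝ → E3 → Fin 3 → Fin 3 → Fin 3 → Fin 3 → ℝ}

lemma isTensorTest_smul {φ : E3 → ℝ} (hφ : IsTestFunction Ω φ) {A : Mat3} (hA : A ∈ QTensor)
    (T : ℝ) : IsTensorTest Ω T (fun _ x => φ x • A)
      (fun _ x i j k => pderiv k (fun y => φ y * A i j) x) (fun _ _ => 0)
      (fun _ _ _ _ _ => 0) where
  tensor _ _ := .of_forall fun _ =>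
    ⟨by rw [Matrix.transpose_smul, hA.1], by rw [Matrix.trace_smul, hA.2, smul_zero]⟩
  tensor_deriv _ _ := .of_forall fun _ => by simp [QTensor]
  mem _ _ i j := IsTestFunction.isH1With (φ := fun y => φ y * A i j)
    ⟨hφ.smooth.mul contDiff_const, hφ.compact.mul_right,
      (tsupport_mul_subset_left (f := φ)).trans hφ.subset⟩
  mem_deriv _ _ i j := by
    have h := IsTestFunction.isH1With (Ω := Ω) (φ := fun _ => (0 : ℝ))
      ⟨contDiff_const, .zero, by simp [tsupport]⟩
    simpa [pderiv] using h
  c1 i j :=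
    { hasDeriv := fun t _ => by simpa [h1Norm] using tendsto_const_nhds
      cont_deriv := fun t _ => by simpa [h1Norm] using tendsto_const_nhds }

/-- The reaction term `ε⁻² DF(Q)` of the Q-tensor equation, on `ℝ⁹`. -/
def bulkReaction (a b c ε : ℝ) (y : EuclideanSpace ℝ (Fin 3 × Fin 3)) :
    EuclideanSpace ℝ (Fin 3 × Fin 3) :=
  (1 / ε ^ 2) • vec (bulkGrad a b c (vec.symm y))

lemma continuous_bulkReaction (a b c ε : ℝ) : Continuous (bulkReaction a b c ε) := by
  have hvec : Continuous vec := vec.toLinearMap.continuous_of_finiteDimensional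
  have hsymm : Continuous vec.symm := vec.symm.toLinearMap.continuous_of_finiteDimensional
  have hsq : Continuous fun y => vec (vec.symm y * vec.symm y) :=
    hvec.comp (hsymm.matrix_mul hsymm)
  unfold bulkReaction
  simp only [vec_bulkGrad, vec.apply_symm_apply]
  fun_prop

lemma inner_bulkReaction_nonneg {c₀ : ℝ} (hc : 0 < c) (hc₀ : 0 ≤ c₀)
    (hμ : b ^ 2 / c ^ 2 - 2 * a / c ≤ c₀ ^ 2) {y : EuclideanSpace ℝ (Fin 3 × Fin 3)}
    (hy : y ∈ qTensorVec) (hyc : c₀ ≤ ‖y‖) : 0 ≤ inner ℝ y (bulkReaction a b c ε y) := by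
  obtain ⟨A, rfl⟩ := vec.surjective y
  rw [bulkReaction, vec.symm_apply_apply, real_inner_smul_right, inner_vec]
  have := dot_bulkGrad_nonneg hc hc₀ hμ (vec_mem_qTensorVec.1 hy).2 hyc
  positivity

lemma norm_bulkReaction_le (y : EuclideanSpace ℝ (Fin 3 × Fin 3)) :
    ‖bulkReaction a b c ε y‖ ≤ 1 / ε ^ 2 * (|a| + |b| + |c| + |b / 3| * ‖vec (1 : Mat3)‖)
      * (1 + ‖y‖ ^ 6) := by
  have h := norm_vec_bulkGrad_le a b c (vec.symm y)
  rw [vec.apply_symm_apply] at h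
  rw [bulkReaction, norm_smul, Real.norm_of_nonneg (by positivity), mul_assoc]
  gcongr

lemma IsWeakSolutionWith.integral_inner_vec_eq
    (h : IsWeakSolutionWith Ω a b c ε T₁ v₀ Q₀ v Dv Q DQ D2Q) {T : ℝ} (hT : T ∈ Ioo 0 T₁)
    {φ : E3 → ℝ} (hφ : IsTestFunction Ω φ) {A : Mat3} (hA : A ∈ QTensor) :
    ((∫ x in Ω, φ x * inner ℝ (vec A) (vec (Q T x)))
        - ∫ x in Ω, φ x * inner ℝ (vec A) (vec (Q 0 x)))
      + (∫ t in (0 : ℝ)..T, ∫ x in Ω, φ x * inner ℝ (vec A) (vec (advect (v t x) (DQ t x))))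
    = ∫ t in (0 : ℝ)..T, ∫ x in Ω, φ x *
        inner ℝ (vec A) (vec (lap (D2Q t x)) - bulkReaction a b c ε (vec (Q t x))) := by
  have hid := h.tensor_eq T hT _ _ _ _ (isTensorTest_smul hφ hA T)
  simpa only [TensorIdentity, ← inner_vec, map_smul, map_sub, map_zero, real_inner_smul_right,
    inner_zero_right, integral_zero, intervalIntegral.integral_zero, sub_zero,
    real_inner_comm (vec A), bulkReaction, vec.symm_apply_apply] using hid

lemma IsWeakSolutionWith.isDriftDiffusion
    (h : IsWeakSolutionWith Ω a b c ε T₁ v₀ Q₀ v Dv Q DQ D2Q) (hT₁ : 0 < T₁) :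
    IsDriftDiffusion Ω qTensorVec (bulkReaction a b c ε) T₁ v (fun t x => vec (Q t x))
      (fun t x k => vec (.of fun i j => DQ t x i j k))
      (fun t x k l => vec (.of fun i j => D2Q t x i j k l)) where
  drift t ht :=
    have ⟨T, htT, hT⟩ := exists_between ht.2
    (h.regularity_v T ⟨ht.1.trans htT, hT⟩).1.mem t ⟨ht.1.le, htT.le⟩
  drift_mem T hT k := (h.regularity_v T hT).2.mem k
  values t ht := (h.tensor t ht).mono fun x => vec_mem_qTensorVec.2
  initial p :=
    have ⟨T, h0T, hT⟩ := exists_between hT₁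
    ((h.regularity_Q T ⟨h0T, hT⟩ p.1 p.2).1.mem 0 ⟨le_rfl, h0T.le⟩).mem
  bounded T hT p :=
    have ⟨C, hC⟩ := (h.regularity_Q T hT p.1 p.2).1.bounded
    ⟨C, fun t ht => hC t (Ioo_subset_Icc_self ht)⟩
  regularity T hT p := (h.regularity_Q T hT p.1 p.2).2
  boundary t ht p := h.boundary_Q t ht p.1 p.2
  equation T hT φ hφ y hy := by
    obtain ⟨A, rfl⟩ := vec.surjective y
    have hadvect : ∀ t x, ∑ k, v t x k • vec (.of fun i j => DQ t x i j k)
        = vec (advect (v t x) (DQ t x)) := fun t x => by ext p; simp [advect]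
    have hlap : ∀ t x, ∑ k, vec (.of fun i j => D2Q t x i j k k) = vec (lap (D2Q t x)) :=
      fun t x => by ext p; simp [lap]
    simp only [hadvect, hlap]
    exact h.integral_inner_vec_eq hT hφ (vec_mem_qTensorVec.1 hy)

end WeakSolutions

end BerisEdwards

end

theorem lemma2p4_general {Ω : Set BerisEdwards.E3} (hΩ : IsOpen Ω) (hvol : volume Ω ≠ ⊤)
    {a b c : ℝ} (hc : 0 < c) {c₀ : ℝ} (hc₀ : 0 ≤ c₀)
    (hμ : b ^ 2 / c ^ 2 - 2 * a / c ≤ c₀ ^ 2) {ε : ℝ} (_hε : ε ≠ 0) {T₁ : ℝ} (hT₁ : 0 < T₁)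
    {v₀ : BerisEdwards.E3 → BerisEdwards.E3} {Q₀ : BerisEdwards.E3 → BerisEdwards.Mat3}
    (hQ₀ : eLpNorm (fun x => BerisEdwards.frobNorm (Q₀ x)) ∞ (volume.restrict Ω) ^ 2 ≤
      ENNReal.ofReal (c₀ ^ 2))
    {v : ℝ → BerisEdwards.E3 → BerisEdwards.E3} {Q : ℝ → BerisEdwards.E3 → BerisEdwards.Mat3}
    (hsol : BerisEdwards.IsWeakSolution Ω a b c ε T₁ v₀ Q₀ v Q) :
    eLpNorm (fun p : BerisEdwards.E3 × ℝ => BerisEdwards.frobNorm (Q p.2 p.1)) ∞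
      (volume.restrict (Ω ×ˢ Ioo 0 T₁)) ≤ ENNReal.ofReal c₀ := by
  obtain ⟨Dv, DQ, D2Q, hsol⟩ := hsol
  have : IsFiniteMeasure (volume.restrict Ω) := isFiniteMeasure_restrict.2 hvol
  rw [ENNReal.ofReal_pow hc₀, ENNReal.pow_le_pow_left_iff two_ne_zero] at hQ₀
  simp only [← BerisEdwards.norm_vec, eLpNorm_norm] at hQ₀ ⊢
  have hinit := eLpNorm_congr_ae (hsol.initial_Q.fun_comp BerisEdwards.vec) |>.trans_le hQ₀
  exact (hsol.isDriftDiffusion hT₁).eLpNorm_le hΩ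
    (BerisEdwards.continuous_bulkReaction a b c ε) BerisEdwards.norm_bulkReaction_le hc₀
    (fun _ => BerisEdwards.inner_bulkReaction_nonneg hc hc₀ hμ) hinit

theorem lemma2p4 (Ω : Set BerisEdwards.E3) (hΩ : BerisEdwards.IsSmoothBoundedDomain Ω)
    (a b c : ℝ) (ha : 0 < a) (hb : 0 < b) (hc : 0 < c)
    (c₀ : ℝ) (hc₀ : 0 < c₀) (hμ : b ^ 2 / c ^ 2 - 2 * a / c ≤ c₀ ^ 2)
    (ε : ℝ) (hε : 0 < ε) (T₁ : ℝ) (hT₁ : 0 < T₁)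
    (v₀ : BerisEdwards.E3 → BerisEdwards.E3) (Q₀ : BerisEdwards.E3 → BerisEdwards.Mat3)
    (hQ₀ : eLpNorm (fun x => BerisEdwards.frobNorm (Q₀ x)) ∞ (volume.restrict Ω) ^ 2 ≤
      ENNReal.ofReal (c₀ ^ 2))
    (v : ℝ → BerisEdwards.E3 → BerisEdwards.E3) (Q : ℝ → BerisEdwards.E3 → BerisEdwards.Mat3)
    (hsol : BerisEdwards.IsWeakSolution Ω a b c ε T₁ v₀ Q₀ v Q) :
    eLpNorm (fun p : BerisEdwards.E3 × ℝ => BerisEdwards.frobNorm (Q p.2 p.1)) ∞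
      (volume.restrict (Ω ×ˢ Ioo 0 T₁)) ≤ ENNReal.ofReal c₀ :=
  lemma2p4_general hΩ.isOpen hΩ.isBounded.measure_lt_top.ne hc hc₀.le hμ hε.ne' hT₁ hQ₀ hsol
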